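/- **Setting.** Fix a first-order signature whose only predicate is equality $\approx$, and an infinite set of variables. A literal is $s\approx t$ or $s\not\approx t$ ($s\,\#\,t$ stands for either; the two sides are unordered); $\mathrm{comp}$ is complement; a clause is a finite multiset of literals; $\bot$ also denotes the empty clause. A closure $C\cdot\sigma$ is a clause with a substitution $\sigma$ such that $C\sigma$ is ground. Most general unifiers are idempotent and introduce no fresh variables. Let $\prec_T$ be a desired term ordering: a well-founded rewrite ordering (transitive, closed under contexts and substitutions), total on ground terms, with only finitely many ground terms below each ground term. A literal $s\approx t$ is compared as the multiset $\{s,t\}$ and $s\not\approx t$ as $\{s,s,t,t\}$; clauses are compared by the multiset extension; $L\prec_T\beta$ and $C\prec_T\beta$ mean that all terms occurring as sides are $\prec_T\beta$. **Trails.** A trail $\Gamma$ is a sequence of annotated ground literals $L\sigma^{\,i:(L\vee C)\cdot\sigma}$ with level $i$. A ground literal $L$ is true (false) in $\Gamma$ if $\Gamma\models L$ ($\Gamma\models\mathrm{comp}(L)$), defined if it is true or false, undefined otherwise. For a ground term $\beta$ it is $\beta$-true ($\beta$-false) if moreover $L\prec_T\beta$; it is $\beta$-undefined if $\beta\prec_T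 L$ or it is undefined, and $\beta$-defined otherwise. A ground clause is $\beta$-true if some literal is, $\beta$-false if all literals are, $\beta$-undefined if neither holds. $\mathrm{conv}(\Gamma)$ is a convergent ground rewrite system, oriented by $\prec_T$ and equivalent to the positive equations in $\Gamma$. A substitution is irreducible if every $x\sigma\neq x$ is. A core of $L$ is a minimal subsequence of $\Gamma$ in which $L$ is defined; the defining literal $\max_\Gamma(L)$ is the rightmost literal of a core whose rightmost literal is as far left as possible (there is none if the only core is empty). The level of a defined $L$ is its annotation if $L\in\Gamma$, else the level of its defining literal, else $0$; the level of a clause is the maximum over its literals ($0$ for the empty clause). A trail literal is a decision literal if its level is one more than that of its predecessor in the trail (than $0$ if it is the first). The ordering $\prec_{\Gamma^*}$ on ground literals, extended to clauses as multisets, is as follows: $\beta$-defined literals of level $0$ come first, ordered by $\prec_T$; then the $\beta$-defined literals of positive level, in the trail order of their defining literals, where for the same defining literal $K$ the order is $K$, then $\mathrm{comp}(K)$, then all others by $\prec_T$; then the $\beta$-undefined literals, ordered by $\prec_T$. **Rewriting.** From variable-disjoint (after renaming) closures $(l_1\approx r_1\vee C_1)\cdot\sigma_1$ and $(l_2\,\#\,r_2\vee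 C_2)\cdot\sigma_2$ with $r_1\sigma_1\prec_T l_1\sigma_1=(l_2\,\#\,r_2)\sigma_2|_p$, a rewrite inference yields $\bigl((l_2\,\#\,r_2)\delta[r_1]_p\,\mu\vee C_1\mu\vee C_2\delta\mu\bigr)\cdot\sigma_1\sigma_2\rho$ with distinguished literal $(l_2\,\#\,r_2)\delta[r_1]_p\,\mu$. Here $\mu$ is the mgu of $(l_2\,\#\,r_2)\delta|_p$ and $l_1$; $\delta$ and $\rho$ are the identity if $p$ is a position of $l_2\,\#\,r_2$, and otherwise $(l_2\,\#\,r_2)\delta$ is the most general instance having position $p$, with fresh variables, and $(l_2\,\#\,r_2)\delta\sigma_2\rho=(l_2\,\#\,r_2)\sigma_2$. A reduction chain from $\Gamma$ is a finite sequence of closures with distinguished literals, each an annotation of $\Gamma$ or the result of a rewrite inference from earlier members. A reduction chain application from $\Gamma$ to an annotated literal $L\delta^{\,o:(L\vee C)\cdot\delta}$ is a minimal reduction chain from $\Gamma,L\delta^{\,o:(L\vee C)\cdot\delta}$ whose last distinguished ground literal is the $\mathrm{conv}(\Gamma)$-normal form of $L\delta$. A refutation from $\Gamma$ and an annotated literal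 that is $\beta$-false in $\Gamma$ is a minimal reduction chain from $\Gamma$ extended by that literal, with last distinguished ground literal of the form $s\not\approx s$. **Rules**, on states $(\Gamma;N;U;\beta;k;D)$, where $D$ is $\top$, $\bot$ or a closure: - *Propagate* ($D=\top$): choose $C_0\vee C_1\vee L\in N\cup U$ and an irreducible (by $\mathrm{conv}(\Gamma)$) grounding $\sigma$ with $\Gamma\models\neg C_0\sigma$, all literals of $C_1\sigma$ equal to $L\sigma$, $\mu$ the mgu of $L$ and the literals of $C_1$, $L\sigma$ $\beta$-undefined, $(C_0\vee L)\mu\sigma\prec_T\beta$, and a reduction chain application from $\Gamma$ to $L\sigma^{\,k:(L\vee C_0)\mu\cdot\sigma}$ with last member $(L_m\vee C_m)\cdot\sigma_m$. Append $L_m\sigma_m^{\,k:(L_m\vee C_m)\cdot\sigma_m}$ to $\Gamma$. - *Decide* ($D=\top$): choose $C_0\vee L\in N\cup U$ and an irreducible grounding $\sigma$ with $C_0\sigma$ $\beta$-undefined or $\beta$-true, $L\sigma$ $\beta$-undefined, $(C_0\vee L)\sigma\prec_T\beta$, and a reduction chain application from $\Gamma$ to $L\sigma^{\,k+1:(L\vee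 C_0)\cdot\sigma}$ with last member $(L_m\vee C_m)\cdot\sigma_m$. Append $L_m\sigma_m^{\,k+1:(L_m\vee\mathrm{comp}(L_m))\cdot\sigma_m}$ and set $k:=k+1$. - *Conflict* ($D=\top$): choose $D'\in N\cup U$ and an irreducible grounding $\sigma$ with $D'\sigma$ $\beta$-false in $\Gamma$. Set $D:=\bot$ if $D'\sigma$ has level $0$, and $D:=D'\cdot\sigma$ otherwise. - *Skip*: if $\Gamma=\Gamma',K,L$ and $D=D'\cdot\sigma$ with $D'\sigma$ $\beta$-false in $\Gamma',K$, remove $L$ and set $k$ to the level of $K$. - *Explore-Refutation*: if $D=(D'\vee L)\cdot\sigma$, $L\sigma$ is strictly $\prec_{\Gamma^*}$-maximal in $(D'\vee L)\sigma$, and the last literal of $\Gamma$ is the defining literal of $L\sigma$, take a member $E\cdot\tau$ of a refutation from $\Gamma$ and $L\sigma$ (annotated by $(D'\vee L)\cdot\sigma$) such that $E\tau\prec_{\Gamma^*}(D'\vee L)\sigma$ and $E\tau$ is $\beta$-false in $\Gamma$. Set $D:=E\cdot\tau$. - *Factorize*: $(D'\vee L\vee L')\cdot\sigma$ becomes $(D'\vee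 L)\mu\cdot\sigma$ if $L\sigma=L'\sigma$ and $\mu$ is the mgu of $L,L'$. - *Equality-Resolution*: $(D'\vee s\not\approx s')\cdot\sigma$ becomes $D'\mu\cdot\sigma$ if $s\sigma=s'\sigma$ and $\mu$ is the mgu of $s,s'$. - *Backtrack*: if $D=(D'\vee L)\cdot\sigma$, $D'\sigma$ has level $<k$, and $\Gamma_0,K$ is the shortest prefix of $\Gamma$ such that for some grounding $\tau$ the clause $(D'\vee L)\tau$ is $\beta$-false in $\Gamma_0,K$ but not in $\Gamma_0$, then set $\Gamma:=\Gamma_0$, $U:=U\cup\{D'\vee L\}$, $D:=\top$, and $k:=j-i$, where $j$ is the level of $K$ and $i=1$ if $K$ is a decision literal, $i=0$ otherwise. - *Grow* ($D=\top$): set $\Gamma:=\epsilon$, $k:=0$ and $\beta:=\beta'$ for a ground term $\beta'$ with $\beta\prec_T\beta'$. **Runs.** A run is a finite or infinite sequence of rule applications starting from $(\epsilon;N;\emptyset;\beta;0;\top)$. It is regular if 1. Conflict and Factorize have precedence over all other rules; 2. if $k=0$, Propagate has precedence over Decide; 3. if Propagate could add a literal $L$ with an annotation clause in $N\cup U$,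 then Decide does not add $\mathrm{comp}(L)$ in that state; 4. between a Conflict and the following Backtrack, Skip is applied at least once, unless that Conflict was applied immediately after Decide; 5. if Conflict is applied immediately after Decide, then the following Backtrack is only applied in a state whose conflict closure $D\cdot\sigma$ has a literal $L\in D$ with $L\sigma=\mathrm{comp}(L')$, where $L'$ is the last trail literal. **Lemma (termination).** Let $N$ be a (possibly infinite) set of clauses and $\beta$ a ground term. Then every regular run from $(\epsilon;N;\emptyset;\beta;0;\top)$ that never uses Grow terminates, that is, it is finite. Moreover, if such a run ends with status $\top$ and cannot be continued, without Grow, to a longer regular run, then no rule other than Grow is applicable to its last state. -/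

import Mathlib

universe u v w

namespace SCLEQ

section Basics

variable {L : FirstOrder.Language.{u, v}} {V : Type w}

/-! ### Terms, substitutions, positions -/

/-- The set of variables of a term. -/
def tvars : L.Term V → Set V
  | .var x => {x}
  | .func _ ts => ⋃ i, tvars (ts i)

/-- A term is ground if it contains no variable. -/
def TGround (t : L.Term V) : Prop := tvars t = ∅

/-- Substitutions are total maps from variables to terms. -/
abbrev Subst (L : FirstOrder.Language.{u, v}) (V : Type w) := V → L.Term V

/-- The composition "first `σ`, then `τ`". -/
def Subst.comp (σ τ : Subst L V) : Subst L V := fun x => (σ x).subst τ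

/-- The subterm `t|_p`, if `p` is a position of `t` (argument places are counted from `0`). -/
def subtermAt : L.Term V → List ℕ → Option (L.Term V)
  | t, [] => some t
  | .var _, _ :: _ => none
  | @FirstOrder.Language.Term.func _ _ n _ ts, i :: p =>
      if h : i < n then subtermAt (ts ⟨i, h⟩) p else none

/-- The replacement `t[s]_p` (it is `t` if `p` is not a position of `t`). -/
def replaceAt : L.Term V → List ℕ → L.Term V → L.Term V
  | _, [], s => s
  | .var x, _ :: _, _ => .var x
  | @FirstOrder.Language.Term.func _ _ n f ts, i :: p, s =>
      if h : i < n then .func f (Function.update ts ⟨i, h⟩ (replaceAt (ts ⟨i, h⟩) p s))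
      else .func f ts

/-! ### Literals and clauses -/

/-- An equational literal: `s ≈ t` if `pos = true`, and `s ≉ t` if `pos = false`. As usual,
equations are unordered, so `s ≈ t` and `t ≈ s` are the same literal. -/
@[ext]
structure Literal (L : FirstOrder.Language.{u, v}) (V : Type w) where
  pos : Bool
  eqn : Sym2 (L.Term V)

/-- Clauses are finite multisets of literals. -/
abbrev Clause (L : FirstOrder.Language.{u, v}) (V : Type w) := Multiset (Literal L V)

/-- The complement of a literal. -/
def Literal.comp (K : Literal L V) : Literal L V := ⟨!K.pos, K.eqn⟩

def Literal.subst (K : Literal L V) (σ : Subst L V) : Literal L V :=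
  ⟨K.pos, K.eqn.map fun t => t.subst σ⟩

def Literal.vars (K : Literal L V) : Set V := {x | ∃ t ∈ K.eqn, x ∈ tvars t}

def Literal.Ground (K : Literal L V) : Prop := K.vars = ∅

def Clause.subst (C : Clause L V) (σ : Subst L V) : Clause L V :=
  Multiset.map (fun K : Literal L V => K.subst σ) C

def Clause.vars (C : Clause L V) : Set V := {x | ∃ K ∈ C, x ∈ K.vars}

def Clause.Ground (C : Clause L V) : Prop := Clause.vars C = ∅

/-! ### Most general unifiers -/

def Unifies (θ : Subst L V) (E : Set (L.Term V × L.Term V)) : Prop :=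
  ∀ e ∈ E, e.1.subst θ = e.2.subst θ

/-- `μ` is an idempotent most general unifier of the equations `E` that uses no fresh variables. -/
structure IsMgu (E : Set (L.Term V × L.Term V)) (μ : Subst L V) : Prop where
  unifies : Unifies μ E
  most_general : ∀ θ, Unifies θ E → ∃ ρ, θ = Subst.comp μ ρ
  idempotent : Subst.comp μ μ = μ
  no_fresh : ∀ x, μ x ≠ .var x →
    (∃ e ∈ E, x ∈ tvars e.1 ∪ tvars e.2) ∧
      ∀ y ∈ tvars (μ x), ∃ e ∈ E, y ∈ tvars e.1 ∪ tvars e.2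

/-- `μ` is a most general unifier of the literal `K` and the literals in `S`. Since equations are
unordered, there can be several ways to match their sides; the one used is a way in which `σ`
unifies the literals (so that `σ` is an instance of `μ`). -/
def IsLitMgu (σ : Subst L V) (K : Literal L V) (S : Clause L V) (μ : Subst L V) : Prop :=
  ∃ (s t : L.Term V) (P : Multiset (L.Term V × L.Term V)),
    K = ⟨K.pos, s(s, t)⟩ ∧
    S = P.map (fun q => (⟨K.pos, s(q.1, q.2)⟩ : Literal L V)) ∧
    (∀ q ∈ P, q.1.subst σ = s.subst σ ∧ q.2.subst σ = t.subst σ) ∧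
    IsMgu {e | ∃ q ∈ P, e = (s, q.1) ∨ e = (t, q.2)} μ

/-! ### Orderings -/

/-- The multiset extension of a relation. -/
def MulLT {α : Type*} (r : α → α → Prop) (M N : Multiset α) : Prop :=
  ∃ X Y Z : Multiset α, Z ≠ 0 ∧ M = X + Y ∧ N = X + Z ∧ ∀ y ∈ Y, ∃ z ∈ Z, r y z

/-- A desired term ordering: a well-founded rewrite ordering that is total on ground terms and
such that only finitely many ground terms are below any ground term. -/
structure IsDesiredTermOrdering (lt : L.Term V → L.Term V → Prop) : Prop where
  wellFounded : WellFounded lt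
  trans : ∀ r s t, lt r s → lt s t → lt r t
  subst : ∀ s t (σ : Subst L V), lt s t → lt (s.subst σ) (t.subst σ)
  context : ∀ (t : L.Term V) (p : List ℕ) (s s' : L.Term V), (subtermAt t p).isSome →
    lt s s' → lt (replaceAt t p s) (replaceAt t p s')
  total : ∀ s t, TGround s → TGround t → s = t ∨ lt s t ∨ lt t s
  finite_below : ∀ t, TGround t → {s | TGround s ∧ lt s t}.Finite

/-- The multiset `{s, t}` for `s ≈ t` and `{s, s, t, t}` for `s ≉ t`. -/
def Literal.toMultiset (K : Literal L V) : Multiset (L.Term V) :=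
  if K.pos then K.eqn.toMultiset else K.eqn.toMultiset + K.eqn.toMultiset

/-- `K ≺_T H` for literals. -/
def LitLT (lt : L.Term V → L.Term V → Prop) (K H : Literal L V) : Prop :=
  MulLT lt K.toMultiset H.toMultiset

/-- `K ≺_T β` for a literal `K` and a term `β`. -/
def LitBelow (lt : L.Term V → L.Term V → Prop) (β : L.Term V) (K : Literal L V) : Prop :=
  MulLT lt K.toMultiset {β}

/-- `β ≺_T K` for a literal `K` and a term `β`. -/
def LitAbove (lt : L.Term V → L.Term V → Prop) (β : L.Term V) (K : Literal L V) : Prop :=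
  MulLT lt {β} K.toMultiset

/-- `C ≺_T β` for a clause `C` and a term `β`. -/
def ClauseBelow (lt : L.Term V → L.Term V → Prop) (β : L.Term V) (C : Clause L V) : Prop :=
  MulLT (MulLT lt) (Multiset.map Literal.toMultiset C) {{β}}

/-! ### Semantics of ground literals -/

/-- Truth of a literal in an `L`-structure under a valuation of the variables. -/
def Literal.Holds (K : Literal L V) (M : Type*) [L.Structure M] (val : V → M) : Prop :=
  K.pos = true ↔ (K.eqn.map fun t => t.realize val).IsDiag

/-- Semantic entailment; it is only used for ground literals. -/
def Entails (Γ : Set (Literal L V)) (K : Literal L V) : Prop :=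
  ∀ (M : Type (max u w)) [L.Structure M] (val : V → M),
    (∀ H ∈ Γ, H.Holds M val) → K.Holds M val

/-- `K` is defined in `Γ`: it is true or false in `Γ`. -/
def Defined (Γ : Set (Literal L V)) (K : Literal L V) : Prop :=
  Entails Γ K ∨ Entails Γ K.comp

def BTrue (lt : L.Term V → L.Term V → Prop) (β : L.Term V) (Γ : Set (Literal L V))
    (K : Literal L V) : Prop :=
  LitBelow lt β K ∧ Entails Γ K

def BFalse (lt : L.Term V → L.Term V → Prop) (β : L.Term V) (Γ : Set (Literal L V))
    (K : Literal L V) : Prop :=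
  LitBelow lt β K ∧ Entails Γ K.comp

def BUndef (lt : L.Term V → L.Term V → Prop) (β : L.Term V) (Γ : Set (Literal L V))
    (K : Literal L V) : Prop :=
  LitAbove lt β K ∨ ¬ Defined Γ K

/-- A clause is `β`-true if one of its literals is. -/
def ClauseBTrue (lt : L.Term V → L.Term V → Prop) (β : L.Term V) (Γ : Set (Literal L V))
    (C : Clause L V) : Prop :=
  ∃ K ∈ C, BTrue lt β Γ K

/-- A clause is `β`-false if all of its literals are. -/
def ClauseBFalse (lt : L.Term V → L.Term V → Prop) (β : L.Term V) (Γ : Set (Literal L V))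
    (C : Clause L V) : Prop :=
  ∀ K ∈ C, BFalse lt β Γ K

/-- A clause is `β`-undefined if it is neither `β`-true nor `β`-false. -/
def ClauseBUndef (lt : L.Term V → L.Term V → Prop) (β : L.Term V) (Γ : Set (Literal L V))
    (C : Clause L V) : Prop :=
  ¬ ClauseBTrue lt β Γ C ∧ ¬ ClauseBFalse lt β Γ C

/-! ### Rewriting -/

/-- One rewrite step with the term rewrite system `R`. -/
def Rewrites (R : Set (L.Term V × L.Term V)) (s t : L.Term V) : Prop :=
  ∃ e ∈ R, ∃ (p : List ℕ) (σ : Subst L V),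
    subtermAt s p = some (e.1.subst σ) ∧ t = replaceAt s p (e.2.subst σ)

def Irreducible (R : Set (L.Term V × L.Term V)) (t : L.Term V) : Prop :=
  ∀ t', ¬ Rewrites R t t'

/-- `t` is the `R`-normal form of `s`. -/
def IsNormalForm (R : Set (L.Term V × L.Term V)) (s t : L.Term V) : Prop :=
  Relation.ReflTransGen (Rewrites R) s t ∧ Irreducible R t

/-- The literal `H` results from `K` by normalizing both of its sides. -/
def IsLitNormalForm (R : Set (L.Term V × L.Term V)) (K H : Literal L V) : Prop :=
  ∃ s t s' t', K = ⟨K.pos, s(s, t)⟩ ∧ H = ⟨K.pos, s(s', t')⟩ ∧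
    IsNormalForm R s s' ∧ IsNormalForm R t t'

/-- A substitution is irreducible if all terms in its codomain are. -/
def IrreducibleSubst (R : Set (L.Term V × L.Term V)) (σ : Subst L V) : Prop :=
  ∀ x, σ x ≠ .var x → Irreducible R (σ x)

/-- `conv(Γ)`: the convergent ground rewrite system given by all ground equations that follow from
the positive equations in `Γ`, oriented by `≺_T`. Any convergent system that is oriented by `≺_T`
and equivalent to the positive equations in `Γ` has the same normal forms on ground terms, namely
the `≺_T`-least elements of the classes, and hence the same irreducible ground terms. -/
def conv (lt : L.Term V → L.Term V → Prop) (Γ : Set (Literal L V)) :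
    Set (L.Term V × L.Term V) :=
  {e | TGround e.1 ∧ TGround e.2 ∧ lt e.2 e.1 ∧
    Entails {K | K ∈ Γ ∧ K.pos = true} ⟨true, s(e.1, e.2)⟩}

/-! ### Trails -/

/-- An annotated ground literal `Kσ^{i:(K ∨ C)·σ}` with level `i`, `K = lead`, `C = rest`. -/
@[ext]
structure AnnLit (L : FirstOrder.Language.{u, v}) (V : Type w) where
  level : ℕ
  lead : Literal L V
  rest : Clause L V
  sub : Subst L V

/-- The ground literal itself. -/
def AnnLit.lit (a : AnnLit L V) : Literal L V := a.lead.subst a.sub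

/-- The clause of the annotation. -/
def AnnLit.clause (a : AnnLit L V) : Clause L V := a.lead ::ₘ a.rest

/-- Trails; the last element is the rightmost (newest) literal. -/
abbrev Trail (L : FirstOrder.Language.{u, v}) (V : Type w) := List (AnnLit L V)

def Trail.lits (Γ : Trail L V) : Set (Literal L V) := {K | ∃ a ∈ Γ, a.lit = K}

/-- The literals of the subsequence of `Γ` given by a set of indices. -/
def Trail.litsAt (Γ : Trail L V) (I : Finset (Fin (List.length Γ))) : Set (Literal L V) :=
  {K | ∃ i ∈ I, (List.get Γ i).lit = K}

/-- The subsequence given by `I` is a core of `K`: a minimal one in which `K` is defined. -/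
def IsCore (Γ : Trail L V) (K : Literal L V) (I : Finset (Fin (List.length Γ))) : Prop :=
  Defined (Trail.litsAt Γ I) K ∧ ∀ J, J ⊂ I → ¬ Defined (Trail.litsAt Γ J) K

/-- The `i`-th literal of `Γ` is the defining literal of `K`: it is the largest literal of a core,
and no core has a smaller largest literal. -/
def IsDefiningIndex (Γ : Trail L V) (K : Literal L V) (i : Fin (List.length Γ)) : Prop :=
  (∃ I, IsCore Γ K I ∧ i ∈ I ∧ ∀ j ∈ I, j ≤ i) ∧ ∀ J, IsCore Γ K J → ∃ j ∈ J, i ≤ j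

open Classical in
/-- The level of a defined ground literal. -/
noncomputable def litLevel (Γ : Trail L V) (K : Literal L V) : ℕ :=
  if h : ∃ a ∈ Γ, a.lit = K then h.choose.level
  else if h : ∃ i, IsDefiningIndex Γ K i then (List.get Γ h.choose).level
  else 0

/-- The level of a ground clause: the maximal level of its literals (`0` for the empty clause). -/
noncomputable def clauseLevel (Γ : Trail L V) (C : Clause L V) : ℕ :=
  (Multiset.map (litLevel Γ) C).sup

/-- The level of the last literal of a trail (`0` for the empty trail). -/
def lastLevel (Γ : Trail L V) : ℕ := ((List.getLast? Γ).map AnnLit.level).getD 0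

/-- `a` is a decision literal after the trail prefix `Γ`: its level exceeds that of its
predecessor by one. -/
def IsDecision (Γ : Trail L V) (a : AnnLit L V) : Prop := a.level = lastLevel Γ + 1

/-! ### The trail induced ordering -/

/-- `β`-defined literals `M_{i,j}` outside `Γ ∪ comp(Γ)` whose defining literal is the `i`-th one. -/
def IsMLit (lt : L.Term V → L.Term V → Prop) (β : L.Term V) (Γ : Trail L V)
    (i : Fin (List.length Γ)) (K : Literal L V) : Prop :=
  ¬ BUndef lt β (Trail.lits Γ) K ∧ K ∉ Trail.lits Γ ∧ K.comp ∉ Trail.lits Γ ∧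
    IsDefiningIndex Γ K i

/-- The clauses of the trail induced ordering `≺_{Γ*}` on ground literals. -/
inductive TrailLTRules (lt : L.Term V → L.Term V → Prop) (β : L.Term V) (Γ : Trail L V) :
    Literal L V → Literal L V → Prop
  | m_m_lt {i k : Fin (List.length Γ)} {K H : Literal L V} (hK : IsMLit lt β Γ i K)
      (hH : IsMLit lt β Γ k H) (lK : 0 < litLevel Γ K) (lH : 0 < litLevel Γ H) (h : i < k) :
      TrailLTRules lt β Γ K H
  | m_m_eq {i : Fin (List.length Γ)} {K H : Literal L V} (hK : IsMLit lt β Γ i K)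
      (hH : IsMLit lt β Γ i H) (lK : 0 < litLevel Γ K) (lH : 0 < litLevel Γ H)
      (h : LitLT lt K H) : TrailLTRules lt β Γ K H
  | l_l {i j : Fin (List.length Γ)} (li : 0 < litLevel Γ (List.get Γ i).lit)
      (lj : 0 < litLevel Γ (List.get Γ j).lit) (h : i < j) :
      TrailLTRules lt β Γ (List.get Γ i).lit (List.get Γ j).lit
  | c_l {i j : Fin (List.length Γ)} (li : 0 < litLevel Γ (List.get Γ i).lit.comp)
      (lj : 0 < litLevel Γ (List.get Γ j).lit) (h : i < j) :
      TrailLTRules lt β Γ (List.get Γ i).lit.comp (List.get Γ j).lit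
  | l_c {i j : Fin (List.length Γ)} (li : 0 < litLevel Γ (List.get Γ i).lit)
      (lj : 0 < litLevel Γ (List.get Γ j).lit.comp) (h : i ≤ j) :
      TrailLTRules lt β Γ (List.get Γ i).lit (List.get Γ j).lit.comp
  | c_c {i j : Fin (List.length Γ)} (li : 0 < litLevel Γ (List.get Γ i).lit.comp)
      (lj : 0 < litLevel Γ (List.get Γ j).lit.comp) (h : i < j) :
      TrailLTRules lt β Γ (List.get Γ i).lit.comp (List.get Γ j).lit.comp
  | l_m {i k : Fin (List.length Γ)} {H : Literal L V} (hH : IsMLit lt β Γ k H)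
      (li : 0 < litLevel Γ (List.get Γ i).lit) (lH : 0 < litLevel Γ H) (h : i ≤ k) :
      TrailLTRules lt β Γ (List.get Γ i).lit H
  | c_m {i k : Fin (List.length Γ)} {H : Literal L V} (hH : IsMLit lt β Γ k H)
      (li : 0 < litLevel Γ (List.get Γ i).lit.comp) (lH : 0 < litLevel Γ H) (h : i ≤ k) :
      TrailLTRules lt β Γ (List.get Γ i).lit.comp H
  | m_l {i k : Fin (List.length Γ)} {K : Literal L V} (hK : IsMLit lt β Γ k K)
      (lK : 0 < litLevel Γ K) (li : 0 < litLevel Γ (List.get Γ i).lit) (h : k < i) :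
      TrailLTRules lt β Γ K (List.get Γ i).lit
  | m_c {i k : Fin (List.length Γ)} {K : Literal L V} (hK : IsMLit lt β Γ k K)
      (lK : 0 < litLevel Γ K) (li : 0 < litLevel Γ (List.get Γ i).lit.comp) (h : k < i) :
      TrailLTRules lt β Γ K (List.get Γ i).lit.comp
  | zero_zero {K H : Literal L V} (hK : ¬ BUndef lt β (Trail.lits Γ) K)
      (hH : ¬ BUndef lt β (Trail.lits Γ) H) (lK : litLevel Γ K = 0) (lH : litLevel Γ H = 0)
      (h : LitLT lt K H) : TrailLTRules lt β Γ K H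
  | zero_pos {K H : Literal L V} (hK : ¬ BUndef lt β (Trail.lits Γ) K)
      (hH : ¬ BUndef lt β (Trail.lits Γ) H) (lK : litLevel Γ K = 0) (lH : 0 < litLevel Γ H) :
      TrailLTRules lt β Γ K H
  | undef_undef {K H : Literal L V} (hK : BUndef lt β (Trail.lits Γ) K)
      (hH : BUndef lt β (Trail.lits Γ) H) (h : LitLT lt K H) : TrailLTRules lt β Γ K H
  | def_undef {K H : Literal L V} (hK : ¬ BUndef lt β (Trail.lits Γ) K)
      (hH : BUndef lt β (Trail.lits Γ) H) : TrailLTRules lt β Γ K H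

/-- The trail induced ordering `≺_{Γ*}` on ground literals. -/
def TrailLT (lt : L.Term V → L.Term V → Prop) (β : L.Term V) (Γ : Trail L V)
    (K H : Literal L V) : Prop :=
  K.Ground ∧ H.Ground ∧ TrailLTRules lt β Γ K H

/-! ### Rewrite inferences, reduction chains, refutations -/

/-- Rewrite steps `(K·σ, (K ∨ C)·σ, R, S, p)` with `K = lead`, `C = rest`: without premises
(`leaf`), or with the premises `R`, `S` and a position (`node`). -/
inductive RewriteStep (L : FirstOrder.Language.{u, v}) (V : Type w)
  | leaf (lead : Literal L V) (rest : Clause L V) (sub : Subst L V)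
  | node (lead : Literal L V) (rest : Clause L V) (sub : Subst L V)
      (R S : RewriteStep L V) (p : List ℕ)

/-- The rewrite literal. -/
def RewriteStep.lead : RewriteStep L V → Literal L V
  | .leaf K _ _ => K
  | .node K _ _ _ _ _ => K

def RewriteStep.rest : RewriteStep L V → Clause L V
  | .leaf _ C _ => C
  | .node _ C _ _ _ _ => C

def RewriteStep.sub : RewriteStep L V → Subst L V
  | .leaf _ _ σ => σ
  | .node _ _ σ _ _ _ => σ

def RewriteStep.clause (I : RewriteStep L V) : Clause L V := I.lead ::ₘ I.rest

/-- The instance `l₂δ` of `l₂` used for rewriting `l₂σ₂` at `p`: `δ` is the identity if `p` is a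
position of `l₂`; otherwise `l₂δ` is the most general instance of `l₂` that has the position `p` and
has `l₂σ₂` as an instance, and `δ` introduces only fresh variables (not in `X`). -/
def IsExpansion (l₂ : L.Term V) (p : List ℕ) (σ₂ : Subst L V) (X : Set V) (δ : Subst L V) : Prop :=
  ((subtermAt l₂ p).isSome ∧ δ = fun x => .var x) ∨
  (subtermAt l₂ p = none ∧
    (subtermAt (l₂.subst δ) p).isSome ∧
    (∃ ρ : Subst L V, (l₂.subst δ).subst ρ = l₂.subst σ₂) ∧
    (∀ δ' : Subst L V, (subtermAt (l₂.subst δ') p).isSome →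
      (∃ ρ' : Subst L V, (l₂.subst δ').subst ρ' = l₂.subst σ₂) →
      ∃ θ : Subst L V, l₂.subst δ' = (l₂.subst δ).subst θ) ∧
    (∀ x, δ x ≠ .var x → x ∈ tvars l₂ ∧ Disjoint (tvars (δ x)) X))

/-- Rewrite inference from variable disjoint closures `(l₁ ≈ r₁ ∨ C₁)·σ₁` and `(K₂ ∨ C₂)·σ₂`, where
`K₂` is `l₂ # r₂` up to the order of its sides and is rewritten below `l₂` at position `p`. The
result is `((l₂ # r₂)δ[r₁]_p μ ∨ C₁μ ∨ C₂δμ)·σ₃`, where `μ` is a most general unifier of `l₂δ|_p` and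
`l₁`, and `σ₃` combines `σ₁`, `σ₂` and the matcher from `l₂δ` to `l₂σ₂`. -/
def IsRewriteResult (lt : L.Term V → L.Term V → Prop)
    (K₁ : Literal L V) (C₁ : Clause L V) (σ₁ : Subst L V)
    (K₂ : Literal L V) (C₂ : Clause L V) (σ₂ : Subst L V) (p : List ℕ)
    (K₃ : Literal L V) (C₃ : Clause L V) (σ₃ : Subst L V) : Prop :=
  Disjoint (Clause.vars (K₁ ::ₘ C₁)) (Clause.vars (K₂ ::ₘ C₂)) ∧
  ∃ (l₁ r₁ l₂ r₂ u : L.Term V) (δ μ : Subst L V),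
    K₁ = ⟨true, s(l₁, r₁)⟩ ∧ K₂ = ⟨K₂.pos, s(l₂, r₂)⟩ ∧
    lt (r₁.subst σ₁) (l₁.subst σ₁) ∧
    subtermAt (l₂.subst σ₂) p = some (l₁.subst σ₁) ∧
    IsExpansion l₂ p σ₂ (Clause.vars (K₁ ::ₘ C₁) ∪ Clause.vars (K₂ ::ₘ C₂)) δ ∧
    subtermAt (l₂.subst δ) p = some u ∧
    IsMgu {(u, l₁)} μ ∧
    K₃ = Literal.subst ⟨K₂.pos, s(replaceAt (l₂.subst δ) p r₁, r₂.subst δ)⟩ μ ∧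
    C₃ = Clause.subst C₁ μ + Clause.subst (Clause.subst C₂ δ) μ ∧
    (∀ x ∈ Clause.vars (K₁ ::ₘ C₁), σ₃ x = σ₁ x) ∧
    (∀ x ∈ Clause.vars (K₂ ::ₘ C₂), σ₃ x = σ₂ x ∧ (δ x).subst σ₃ = σ₂ x)

/-- The renaming substitution of a permutation of the variables. -/
def renameSubst (L : FirstOrder.Language.{u, v}) {V : Type w} (e : V ≃ V) : Subst L V := fun x => .var (e x)

/-- `I` is the result of a rewrite inference from `R` and `S` at `p`. The clauses of the two
premises are first made variable disjoint by renaming; a closure `C·σ` is renamed by `e` to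
`(C e)·(e⁻¹ σ)`. -/
def IsRewriteInference (lt : L.Term V → L.Term V → Prop) (R S : RewriteStep L V) (p : List ℕ)
    (I : RewriteStep L V) : Prop :=
  ∃ e₁ e₂ : V ≃ V,
    IsRewriteResult lt
      (R.lead.subst (renameSubst L e₁)) (Clause.subst R.rest (renameSubst L e₁))
      (fun x => R.sub (e₁.symm x))
      (S.lead.subst (renameSubst L e₂)) (Clause.subst S.rest (renameSubst L e₂))
      (fun x => S.sub (e₂.symm x))
      p I.lead I.rest I.sub

/-- A reduction chain from `Γ`: every step is the closure of a literal of `Γ`, or the result of a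
rewrite inference from two earlier steps. -/
def IsReductionChain (lt : L.Term V → L.Term V → Prop) (Γ : Trail L V)
    (P : List (RewriteStep L V)) : Prop :=
  ∀ i : Fin P.length,
    (∃ a ∈ Γ, P.get i = .leaf a.lead a.rest a.sub) ∨
    ∃ j k : Fin P.length, j < i ∧ k < i ∧ ∃ p K C σ,
      P.get i = .node K C σ (P.get j) (P.get k) p ∧
      IsRewriteInference lt (P.get j) (P.get k) p (P.get i)

/-- A reduction chain from `Γ, a` that ends in the `conv(Γ)`-normal form of the literal of `a`. -/
def IsPreReductionChainApp (lt : L.Term V → L.Term V → Prop) (Γ : Trail L V) (a : AnnLit L V)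
    (P : List (RewriteStep L V)) : Prop :=
  IsReductionChain lt (Γ ++ [a]) P ∧
  ∃ I, P.getLast? = some I ∧
    IsLitNormalForm (conv lt (Trail.lits Γ)) a.lit (I.lead.subst I.sub)

/-- A (minimal) reduction chain application from `Γ` to the annotated literal `a`. -/
def IsReductionChainApp (lt : L.Term V → L.Term V → Prop) (Γ : Trail L V) (a : AnnLit L V)
    (P : List (RewriteStep L V)) : Prop :=
  IsPreReductionChainApp lt Γ a P ∧
  ∀ i < P.length, ¬ IsPreReductionChainApp lt Γ a (P.eraseIdx i)

/-- A reduction chain from `Γ, a` that ends in a literal `s ≉ s`. -/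
def IsPreRefutation (lt : L.Term V → L.Term V → Prop) (Γ : Trail L V) (a : AnnLit L V)
    (P : List (RewriteStep L V)) : Prop :=
  IsReductionChain lt (Γ ++ [a]) P ∧
  ∃ I s, P.getLast? = some I ∧ I.lead.subst I.sub = ⟨false, s(s, s)⟩

/-- A (minimal) refutation from `Γ` and the annotated literal `a`, which is `β`-false in `Γ`. -/
def IsRefutation (lt : L.Term V → L.Term V → Prop) (β : L.Term V) (Γ : Trail L V) (a : AnnLit L V)
    (P : List (RewriteStep L V)) : Prop :=
  BFalse lt β (Trail.lits Γ) a.lit ∧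
  IsPreRefutation lt Γ a P ∧
  ∀ i, i + 1 < P.length → ¬ IsPreRefutation lt Γ a (P.eraseIdx i)

/-! ### States and rules -/

/-- The last component of a state: `⊤`, `⊥`, or a closure `C·σ`. -/
inductive Status (L : FirstOrder.Language.{u, v}) (V : Type w)
  | top
  | bot
  | conflict (C : Clause L V) (σ : Subst L V)

/-- States `(Γ; N; U; β; k; D)`. -/
@[ext]
structure State (L : FirstOrder.Language.{u, v}) (V : Type w) where
  trail : Trail L V
  N : Set (Clause L V)
  U : Set (Clause L V)
  β : L.Term V
  k : ℕ
  status : Status L V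

/-- The initial state `(ε; N; ∅; β; 0; ⊤)`. -/
def initialState (N : Set (Clause L V)) (β : L.Term V) : State L V := ⟨[], N, ∅, β, 0, .top⟩

/-- The names of the rules. -/
inductive Rule
  | propagate
  | decide
  | conflict
  | skip
  | exploreRefutation
  | factorize
  | equalityResolution
  | backtrack
  | grow

/-- `S` turns into `T` by Propagate, which adds the annotated literal `a`. -/
def PropagateStep (lt : L.Term V → L.Term V → Prop) (S T : State L V) (a : AnnLit L V) : Prop :=
  S.status = .top ∧
  ∃ (C₀ C₁ : Clause L V) (K : Literal L V) (σ μ : Subst L V)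
    (P : List (RewriteStep L V)) (I : RewriteStep L V),
    (C₀ + C₁ + {K}) ∈ S.N ∪ S.U ∧
    Clause.Ground (Clause.subst (C₀ + C₁ + {K}) σ) ∧
    (∀ H ∈ Clause.subst C₀ σ, Entails (Trail.lits S.trail) H.comp) ∧
    (∀ H ∈ C₁, H.subst σ = K.subst σ) ∧
    IsLitMgu σ K C₁ μ ∧
    BUndef lt S.β (Trail.lits S.trail) (K.subst σ) ∧
    ClauseBelow lt S.β (Clause.subst (Clause.subst (C₀ + {K}) μ) σ) ∧
    IrreducibleSubst (conv lt (Trail.lits S.trail)) σ ∧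
    IsReductionChainApp lt S.trail ⟨S.k, K.subst μ, Clause.subst C₀ μ, σ⟩ P ∧
    P.getLast? = some I ∧
    a = ⟨S.k, I.lead, I.rest, I.sub⟩ ∧
    T = { S with trail := S.trail ++ [a] }

/-- `S` turns into `T` by Decide, which adds the annotated literal `a`. -/
def DecideStep (lt : L.Term V → L.Term V → Prop) (S T : State L V) (a : AnnLit L V) : Prop :=
  S.status = .top ∧
  ∃ (C₀ : Clause L V) (K : Literal L V) (σ : Subst L V)
    (P : List (RewriteStep L V)) (I : RewriteStep L V),
    (C₀ + {K}) ∈ S.N ∪ S.U ∧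
    Clause.Ground (Clause.subst (C₀ + {K}) σ) ∧
    (ClauseBUndef lt S.β (Trail.lits S.trail) (Clause.subst C₀ σ) ∨
      ClauseBTrue lt S.β (Trail.lits S.trail) (Clause.subst C₀ σ)) ∧
    BUndef lt S.β (Trail.lits S.trail) (K.subst σ) ∧
    ClauseBelow lt S.β (Clause.subst (C₀ + {K}) σ) ∧
    IrreducibleSubst (conv lt (Trail.lits S.trail)) σ ∧
    IsReductionChainApp lt S.trail ⟨S.k + 1, K, C₀, σ⟩ P ∧
    P.getLast? = some I ∧
    a = ⟨S.k + 1, I.lead, {I.lead.comp}, I.sub⟩ ∧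
    T = { S with trail := S.trail ++ [a], k := S.k + 1 }

open Classical in
def ConflictStep (lt : L.Term V → L.Term V → Prop) (S T : State L V) : Prop :=
  S.status = .top ∧
  ∃ (D : Clause L V) (σ : Subst L V),
    D ∈ S.N ∪ S.U ∧
    Clause.Ground (Clause.subst D σ) ∧
    ClauseBFalse lt S.β (Trail.lits S.trail) (Clause.subst D σ) ∧
    IrreducibleSubst (conv lt (Trail.lits S.trail)) σ ∧
    T = { S with status :=
            if clauseLevel S.trail (Clause.subst D σ) = 0 then .bot else .conflict D σ }

def SkipStep (lt : L.Term V → L.Term V → Prop) (S T : State L V) : Prop :=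
  ∃ (Γ : Trail L V) (a b : AnnLit L V) (D : Clause L V) (σ : Subst L V),
    S.trail = Γ ++ [a, b] ∧
    S.status = .conflict D σ ∧
    ClauseBFalse lt S.β (Trail.lits (Γ ++ [a])) (Clause.subst D σ) ∧
    T = { S with trail := Γ ++ [a], k := a.level }

/-- Explore-Refutation. Here `≺_{Γ*}`, refutations and falsity refer to the whole current trail. -/
def ExploreRefutationStep (lt : L.Term V → L.Term V → Prop) (S T : State L V) : Prop :=
  ∃ (D : Clause L V) (K : Literal L V) (σ : Subst L V) (i : Fin (List.length S.trail))
    (P : List (RewriteStep L V)) (I : RewriteStep L V),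
    S.status = .conflict (D + {K}) σ ∧
    (∀ H ∈ Clause.subst D σ, H ≠ K.subst σ ∧ ¬ TrailLT lt S.β S.trail (K.subst σ) H) ∧
    (i : ℕ) + 1 = List.length S.trail ∧
    IsDefiningIndex S.trail (K.subst σ) i ∧
    IsRefutation lt S.β S.trail ⟨S.k, K, D, σ⟩ P ∧
    I ∈ P ∧
    MulLT (TrailLT lt S.β S.trail) (Clause.subst I.clause I.sub) (Clause.subst (D + {K}) σ) ∧
    ClauseBFalse lt S.β (Trail.lits S.trail) (Clause.subst I.clause I.sub) ∧
    T = { S with status := .conflict I.clause I.sub }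

def FactorizeStep (S T : State L V) : Prop :=
  ∃ (D : Clause L V) (K K' : Literal L V) (σ μ : Subst L V),
    S.status = .conflict (D + {K} + {K'}) σ ∧
    K.subst σ = K'.subst σ ∧
    IsLitMgu σ K {K'} μ ∧
    T = { S with status := .conflict (Clause.subst (D + {K}) μ) σ }

def EqualityResolutionStep (S T : State L V) : Prop :=
  ∃ (D : Clause L V) (s s' : L.Term V) (σ μ : Subst L V),
    S.status = .conflict (D + {⟨false, s(s, s')⟩}) σ ∧
    s.subst σ = s'.subst σ ∧
    IsMgu {(s, s')} μ ∧
    T = { S with status := .conflict (Clause.subst D μ) σ }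

/-- Some ground instance of `C` is `β`-false in `Γ, a` but not in `Γ`. -/
def BecomesFalse (lt : L.Term V → L.Term V → Prop) (β : L.Term V) (Γ : Trail L V) (a : AnnLit L V)
    (C : Clause L V) : Prop :=
  ∃ τ : Subst L V, Clause.Ground (Clause.subst C τ) ∧
    ClauseBFalse lt β (Trail.lits (Γ ++ [a])) (Clause.subst C τ) ∧
    ¬ ClauseBFalse lt β (Trail.lits Γ) (Clause.subst C τ)

open Classical in
def BacktrackStep (lt : L.Term V → L.Term V → Prop) (S T : State L V) : Prop :=
  ∃ (Γ Γ' : Trail L V) (a : AnnLit L V) (D : Clause L V) (K : Literal L V) (σ : Subst L V),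
    S.trail = Γ ++ [a] ++ Γ' ∧
    S.status = .conflict (D + {K}) σ ∧
    clauseLevel S.trail (Clause.subst D σ) < S.k ∧
    BecomesFalse lt S.β Γ a (D + {K}) ∧
    (∀ (Δ Δ' : Trail L V) (b : AnnLit L V), S.trail = Δ ++ [b] ++ Δ' →
      BecomesFalse lt S.β Δ b (D + {K}) → List.length Γ ≤ List.length Δ) ∧
    T = { S with
          trail := Γ
          U := S.U ∪ {D + {K}}
          k := a.level - (if IsDecision Γ a then 1 else 0)
          status := .top }

def GrowStep (lt : L.Term V → L.Term V → Prop) (S T : State L V) : Prop :=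
  S.status = .top ∧
  ∃ β' : L.Term V, TGround β' ∧ lt S.β β' ∧
    T = { S with trail := [], β := β', k := 0 }

/-- `S` turns into `T` by one application of the given rule. -/
def Step (lt : L.Term V → L.Term V → Prop) : Rule → State L V → State L V → Prop
  | .propagate, S, T => ∃ a, PropagateStep lt S T a
  | .decide, S, T => ∃ a, DecideStep lt S T a
  | .conflict, S, T => ConflictStep lt S T
  | .skip, S, T => SkipStep lt S T
  | .exploreRefutation, S, T => ExploreRefutationStep lt S T
  | .factorize, S, T => FactorizeStep S T
  | .equalityResolution, S, T => EqualityResolutionStep S T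
  | .backtrack, S, T => BacktrackStep lt S T
  | .grow, S, T => GrowStep lt S T

def Applicable (lt : L.Term V → L.Term V → Prop) (r : Rule) (S : State L V) : Prop :=
  ∃ T, Step lt r S T

/-! ### Runs -/

/-- A run of length `n ≤ ∞` from the initial state: for `i < n`, the `i`-th step leads from `s i` to
`s (i + 1)` by the rule `r i`. -/
def IsRun (lt : L.Term V → L.Term V → Prop) (N : Set (Clause L V)) (β : L.Term V) (n : ℕ∞)
    (s : ℕ → State L V) (r : ℕ → Rule) : Prop :=
  s 0 = initialState N β ∧ ∀ i : ℕ, (i : ℕ∞) < n → Step lt (r i) (s i) (s (i + 1))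

/-- Regular runs. -/
structure IsRegularRun (lt : L.Term V → L.Term V → Prop) (N : Set (Clause L V)) (β : L.Term V)
    (n : ℕ∞) (s : ℕ → State L V) (r : ℕ → Rule) : Prop where
  run : IsRun lt N β n s r
  /-- Conflict and Factorize have precedence over all other rules. -/
  precedence : ∀ i : ℕ, (i : ℕ∞) < n → r i ≠ .conflict → r i ≠ .factorize →
    ¬ Applicable lt .conflict (s i) ∧ ¬ Applicable lt .factorize (s i)
  /-- At level `0`, Propagate has precedence over Decide. -/
  propagate_first : ∀ i : ℕ, (i : ℕ∞) < n → r i = .decide → (s i).k = 0 →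
    ¬ Applicable lt .propagate (s i)
  /-- Decide does not add the complement of a literal that Propagate could add with an annotation
  clause from `N ∪ U`. -/
  no_complement : ∀ i : ℕ, (i : ℕ∞) < n → r i = .decide →
    ∀ (T : State L V) (a b : AnnLit L V), PropagateStep lt (s i) T a →
      a.clause ∈ (s i).N ∪ (s i).U → (s (i + 1)).trail = (s i).trail ++ [b] →
      b.lit ≠ a.lit.comp
  /-- If the last Conflict before Backtrack was not immediately preceded by Decide, then Skip was
  applied in between. -/
  skip_once : ∀ i j : ℕ, (i : ℕ∞) < n → r i = .backtrack → j < i → r j = .conflict →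
    (∀ l, j < l → l < i → r l ≠ .conflict) → ¬ (0 < j ∧ r (j - 1) = .decide) →
    ∃ l, j < l ∧ l < i ∧ r l = .skip
  /-- If it was, then the conflict clause contains the complement of the last trail literal. -/
  after_decide : ∀ i j : ℕ, (i : ℕ∞) < n → r i = .backtrack → j < i → r j = .conflict →
    (∀ l, j < l → l < i → r l ≠ .conflict) → (0 < j ∧ r (j - 1) = .decide) →
    ∃ (Γ : Trail L V) (a : AnnLit L V) (D : Clause L V) (σ : Subst L V),
      (s i).trail = Γ ++ [a] ∧ (s i).status = .conflict D σ ∧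
      ∃ K ∈ D, K.subst σ = a.lit.comp

end Basics

end SCLEQ

/-! Only finitely many ground terms, hence finitely many ground literals, lie below `β`. A trail
literal is below `β` and undefined in the trail before it, so trail lengths are bounded. A conflict
phase is finite as well: Skip shortens the trail, and the other rules that keep a conflict closure
make its ground clause smaller in the multiset extension of `≺_{Γ*}`, which is well-founded on
clauses that are `β`-false in the trail. So an infinite run backtracks infinitely often
(`exists_backtrack`).

To bound the Backtrack steps, give each ground clause a profile: the set of its literals and the set
of those that occur exactly once. There are finitely many profiles below `β`, and each Backtrack
adds a new one (`IsRegularRun.exists_new_profile`). If Skip was used since the last Conflict, the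
learned instance is false in a proper prefix of the trail at that Conflict. Precedence of Conflict
and the shortest prefix chosen by Backtrack keep proper prefixes free of false instances of known
clauses (`StepKind.prefixInv`), and falsity depends only on the set of literals. Otherwise Conflict
came directly after the decision of some `a`, and the learned instance is `comp a` together with
literals of lower level, which were false before the decision. A known instance with the same
profile would contain `comp a` exactly once; Propagate could then have added `comp a` with that
known clause as annotation, and regularity would have forbidden the decision
(`DecideStep.profile_notMem`). Multiplicity one matters, since merging repeated literals changes the
annotation clause.

The exception is a clause with an instance that is false in the empty trail. Then Conflict is
applicable in every `⊤` state, so the trail never grows, while each Backtrack shortens it.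

For the second claim, Conflict, Propagate and Decide are excluded in this order: once the earlier
ones are inapplicable, using the next one would be a regular continuation. The remaining rules need
a conflict closure. -/

namespace SCLEQ

open FirstOrder.Language

/-! ### Well-foundedness of the multiset extension -/

section Multisets

theorem singleton_eq_add {α : Type*} {b : α} {X Z : Multiset α} (h : {b} = X + Z) :
    X = {b} ∧ Z = 0 ∨ X = 0 ∧ Z = {b} := by
  induction X using Multiset.induction_on with
  | empty => exact .inr ⟨rfl, by simpa using h.symm⟩
  | cons a X _ =>
    rw [Multiset.cons_add, Multiset.singleton_eq_cons_iff] at h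
    obtain ⟨rfl, h⟩ := h
    obtain ⟨rfl, rfl⟩ : X = 0 ∧ Z = 0 := by simpa using h
    exact .inl ⟨rfl, rfl⟩

theorem MulLT.singleton_iff {α : Type*} {r : α → α → Prop} {M : Multiset α} {b : α} :
    MulLT r M {b} ↔ ∀ m ∈ M, r m b := by
  constructor
  · rintro ⟨X, Y, Z, hZ, rfl, hN, h⟩ m hm
    rcases singleton_eq_add hN with ⟨rfl, rfl⟩ | ⟨rfl, rfl⟩
    · exact absurd rfl hZ
    · obtain ⟨z, hz, hr⟩ := h m (by simpa using hm)
      rw [Multiset.mem_singleton] at hz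
      exact hz ▸ hr
  · intro h
    exact ⟨0, M, {b}, by simp, by simp, by simp, fun y hy => ⟨b, by simp, h y hy⟩⟩

/-- The elements of `Z` can be exchanged one at a time: `z` accounts for all members of `Y` below
it, the rest of `Z` for the others. Well-foundedness is thereby inherited from `Relation.CutExpand`.
-/
theorem MulLT.transGen_cutExpand {α : Type*} {r : α → α → Prop} {M N : Multiset α}
    (h : MulLT r M N) : Relation.TransGen (Relation.CutExpand r) M N := by
  classical
  obtain ⟨X, Y, Z, hZ, rfl, rfl, h⟩ := h
  induction Z using Multiset.induction_on generalizing X Y with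
  | empty => exact absurd rfl hZ
  | cons z Z ih =>
    by_cases hZ' : Z = 0
    · subst hZ'
      refine .single ⟨Y, z, fun y hy => ?_, ?_⟩
      · obtain ⟨z', hz', hr⟩ := h y hy
        have : z' = z := by simpa using hz'
        exact this ▸ hr
      · rw [Multiset.cons_zero]
        ac_rfl
    · have hstep := ih (X := X + {z}) (Y := Y.filter fun y => ¬ r y z) hZ' (by
        intro y hy
        obtain ⟨hy, hyz⟩ := Multiset.mem_filter.1 hy
        obtain ⟨z', hz', hr⟩ := h y hy
        rcases Multiset.mem_cons.1 hz' with rfl | hz'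
        · exact absurd hr hyz
        · exact ⟨z', hz', hr⟩)
      have e : X + {z} + Z = X + z ::ₘ Z := by rw [add_assoc, Multiset.singleton_add]
      rw [e] at hstep
      refine .head ⟨Y.filter fun y => r y z, z, fun y hy => (Multiset.mem_filter.1 hy).2, ?_⟩ hstep
      conv_lhs => rw [← Multiset.filter_add_not (fun y => r y z) Y]
      ac_rfl

theorem wellFounded_mulLT {α : Type*} {r : α → α → Prop} (h : WellFounded r) :
    WellFounded (MulLT r) :=
  Subrelation.wf (fun h => MulLT.transGen_cutExpand h) h.cutExpand.transGen

end Multisets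

/-! ### Terms, positions and the term ordering -/

section Terms

variable {L : FirstOrder.Language.{u, v}} {V : Type w}

theorem subst_congr {t : L.Term V} {σ τ : Subst L V} (h : ∀ x ∈ tvars t, σ x = τ x) :
    t.subst σ = t.subst τ := by
  induction t with
  | var x => exact h x rfl
  | func f ts ih =>
    simp only [Term.subst]
    congr 1
    funext i
    exact ih i fun x hx => h x (Set.mem_iUnion.2 ⟨i, hx⟩)

theorem subst_var (t : L.Term V) : t.subst Term.var = t := by
  induction t with
  | var x => rfl
  | func f ts ih => simp [Term.subst, ih]

theorem TGround.subst_eq {t : L.Term V} (h : TGround t) (σ : Subst L V) : t.subst σ = t := by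
  conv_rhs => rw [← subst_var t]
  exact subst_congr fun x hx => by rw [h] at hx; exact hx.elim

theorem subst_subst (t : L.Term V) (σ τ : Subst L V) :
    (t.subst σ).subst τ = t.subst (Subst.comp σ τ) := by
  induction t with
  | var x => rfl
  | func f ts ih => simp [Term.subst, ih]

theorem exists_subtermAt_of_mem_tvars {t : L.Term V} {x : V} (h : x ∈ tvars t) :
    ∃ p, ∀ σ : Subst L V, subtermAt (t.subst σ) p = some (σ x) := by
  induction t with
  | var y =>
    obtain rfl : x = y := h
    exact ⟨[], fun σ => by simp [subtermAt, Term.subst]⟩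
  | @func n f ts ih =>
    obtain ⟨i, hi⟩ := Set.mem_iUnion.1 h
    obtain ⟨p, hp⟩ := ih i hi
    exact ⟨i :: p, fun σ => by simp [subtermAt, Term.subst, hp]⟩

theorem replaceAt_of_subtermAt {t s : L.Term V} {p : List ℕ} (h : subtermAt t p = some s) :
    replaceAt t p s = t := by
  induction t generalizing p with
  | var x =>
    cases p with
    | nil => simpa [subtermAt, replaceAt, eq_comm] using h
    | cons i p => rfl
  | @func n f ts ih =>
    cases p with
    | nil => simpa [subtermAt, replaceAt, eq_comm] using h
    | cons i p =>
      by_cases hi : i < n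
      · simp only [subtermAt, hi, dif_pos] at h
        simp [replaceAt, hi, ih _ h]
      · simp [subtermAt, hi] at h

theorem realize_replaceAt {t s s' : L.Term V} {p : List ℕ} {M : Type*} [L.Structure M]
    {val : V → M} (h : subtermAt t p = some s) (e : s.realize val = s'.realize val) :
    (replaceAt t p s').realize val = t.realize val := by
  induction t generalizing p with
  | var x =>
    cases p with
    | nil =>
      simp only [subtermAt, Option.some.injEq] at h
      simp [replaceAt, h, e]
    | cons i p => rfl
  | @func n f ts ih =>
    cases p with
    | nil =>
      simp only [subtermAt, Option.some.injEq] at h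
      simp only [replaceAt, h, e]
    | cons i p =>
      by_cases hi : i < n
      · simp only [subtermAt, hi, dif_pos] at h
        simp only [replaceAt, hi, dif_pos, Term.realize_func]
        congr 1
        funext j
        by_cases hj : j = ⟨i, hi⟩
        · subst hj
          simp [ih _ h]
        · simp [Function.update_of_ne hj]
      · simp [subtermAt, hi] at h

variable {lt : L.Term V → L.Term V → Prop}

/-- A term below a ground term is ground: otherwise iterating its context would give an infinite
descending chain. -/
theorem IsDesiredTermOrdering.ground_of_lt (hlt : IsDesiredTermOrdering lt) {t g : L.Term V}
    (hg : TGround g) (h : lt t g) : TGround t := by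
  by_contra ht
  obtain ⟨x, hx⟩ := Set.nonempty_iff_ne_empty.2 ht
  obtain ⟨p, hp⟩ := exists_subtermAt_of_mem_tvars hx
  -- All variables become `g`, so an instance of `t` that contains `g` at position `p` is still
  -- below `g`.
  have hu : lt (t.subst fun _ => g) g := by
    simpa [hg.subst_eq] using hlt.subst _ _ (fun _ => g) h
  have hpu := hp fun _ => g
  generalize t.subst (fun _ => g) = q at hu hpu
  have hF := replaceAt_of_subtermAt hpu
  have hsome : (subtermAt q p).isSome := by simp [hpu]
  -- This set contains `g` and, by the context property, is closed under `y ↦ replaceAt q p y`,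
  -- which decreases its members; so it has no minimal element.
  obtain ⟨m, hm, hmin⟩ := hlt.wellFounded.has_min {y | lt (replaceAt q p y) y}
    ⟨g, by simpa [hF] using hu⟩
  exact hmin _ (hlt.context q p _ _ hsome hm) hm

theorem IsDesiredTermOrdering.irrefl (hlt : IsDesiredTermOrdering lt) (t : L.Term V) :
    ¬ lt t t := fun h => hlt.wellFounded.asymmetric _ _ h h

/-- Replacing arguments by smaller or equal ones gives a smaller or equal term. -/
theorem IsDesiredTermOrdering.func_le (hlt : IsDesiredTermOrdering lt) {n : ℕ}
    (f : L.Functions n) (ts us : Fin n → L.Term V) (h : ∀ i, us i = ts i ∨ lt (us i) (ts i)) :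
    Term.func f us = Term.func f ts ∨ lt (Term.func f us) (Term.func f ts) := by
  classical
  -- The arguments in `S` are already replaced; the context property changes one position at a time.
  have key : ∀ S : Finset (Fin n),
      Term.func f (fun i => if i ∈ S then us i else ts i) = Term.func f ts ∨
        lt (Term.func f (fun i => if i ∈ S then us i else ts i)) (Term.func f ts) := by
    intro S
    induction S using Finset.induction_on with
    | empty => simp
    | insert i S hi ih =>
      set a : Fin n → L.Term V := fun j => if j ∈ S then us j else ts j
      have ha : (fun j => if j ∈ insert i S then us j else ts j) = Function.update a i (us i) := by
        funext j
        by_cases hj : j = i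
        · subst hj; simp
        · simp [hj, a]
      have hai : a i = ts i := by simp [a, hi]
      rw [ha]
      rcases h i with e | e
      · have : Function.update a i (us i) = a := by rw [e, ← hai, Function.update_eq_self]
        rwa [this]
      · have hc := hlt.context (Term.func f a) [i] _ _ (by simp [subtermAt]) e
        have h2 : replaceAt (Term.func f a) [(i : ℕ)] (ts i) = Term.func f a := by
          simp [replaceAt, ← hai]
        rw [h2] at hc
        have h1 : replaceAt (Term.func f a) [(i : ℕ)] (us i) =
            Term.func f (Function.update a i (us i)) := by
          simp [replaceAt]
        rw [h1] at hc
        rcases ih with ih | ih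
        · exact .inr (ih ▸ hc)
        · exact .inr (hlt.trans _ _ _ hc ih)
  simpa using key Finset.univ

theorem IsDesiredTermOrdering.subst_le (hlt : IsDesiredTermOrdering lt) (t : L.Term V)
    {σ τ : Subst L V} (h : ∀ x ∈ tvars t, τ x = σ x ∨ lt (τ x) (σ x)) :
    t.subst τ = t.subst σ ∨ lt (t.subst τ) (t.subst σ) := by
  induction t with
  | var x => exact h x rfl
  | func f ts ih =>
    exact hlt.func_le f _ _ fun i => ih i fun x hx => h x (Set.mem_iUnion.2 ⟨i, hx⟩)

end Terms

/-! ### Rewriting with `conv(Γ)` and normalized substitutions -/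

section Rewriting

variable {L : FirstOrder.Language.{u, v}} {V : Type w} {lt : L.Term V → L.Term V → Prop}
  {Γ : Set (Literal L V)}

/-- `M` with the valuation `val` is a model of `Γ`. -/
def Models (Γ : Set (Literal L V)) (M : Type*) [L.Structure M] (val : V → M) : Prop :=
  ∀ H ∈ Γ, H.Holds M val

/-- The rules are ground, so the matching substitution plays no role: their orientation gives the
descent, their entailment the equality of values. -/
theorem Rewrites.lt_and_realize (hlt : IsDesiredTermOrdering lt) {s t : L.Term V}
    (h : Rewrites (conv lt Γ) s t) :
    lt t s ∧ ∀ (M : Type (max u w)) [L.Structure M] (val : V → M), Models Γ M val →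
      t.realize val = s.realize val := by
  obtain ⟨e, ⟨g1, g2, hl, he⟩, p, σ, hs, rfl⟩ := h
  rw [g1.subst_eq] at hs
  rw [g2.subst_eq]
  constructor
  · have := hlt.context s p _ _ (by simp [hs]) hl
    rwa [replaceAt_of_subtermAt hs] at this
  · intro M _ val hM
    refine realize_replaceAt hs ?_
    have := he M val fun H hH => hM H hH.1
    simpa [Literal.Holds] using this

theorem reflTransGen_rewrites (hlt : IsDesiredTermOrdering lt) {s t : L.Term V}
    (h : Relation.ReflTransGen (Rewrites (conv lt Γ)) s t) :
    (t = s ∨ lt t s) ∧ ∀ (M : Type (max u w)) [L.Structure M] (val : V → M), Models Γ M val →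
      t.realize val = s.realize val := by
  induction h with
  | refl => exact ⟨.inl rfl, fun _ _ _ _ => rfl⟩
  | tail _ h ih =>
    obtain ⟨h1, h2⟩ := h.lt_and_realize hlt
    refine ⟨.inr ?_, fun M _ val hM => (h2 M val hM).trans (ih.2 M val hM)⟩
    rcases ih.1 with e | e
    · exact e ▸ h1
    · exact hlt.trans _ _ _ h1 e

theorem exists_isNormalForm (hlt : IsDesiredTermOrdering lt) (Γ : Set (Literal L V))
    (s : L.Term V) : ∃ t, IsNormalForm (conv lt Γ) s t := by
  induction s using hlt.wellFounded.induction with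
  | _ s ih =>
    by_cases h : Irreducible (conv lt Γ) s
    · exact ⟨s, .refl, h⟩
    · simp only [Irreducible, not_forall, not_not] at h
      obtain ⟨t, ht⟩ := h
      obtain ⟨n, hn, hi⟩ := ih t (ht.lt_and_realize hlt).1
      exact ⟨n, .head ht hn, hi⟩

theorem IsNormalForm.eq_of_irreducible {R : Set (L.Term V × L.Term V)} {s t : L.Term V}
    (h : IsNormalForm R s t) (hs : Irreducible R s) : t = s := by
  rcases Relation.ReflTransGen.cases_head h.1 with e | ⟨c, hc, _⟩
  · exact e.symm
  · exact absurd hc (hs c)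

/-- A redex in `σ x` reappears in `t.subst σ` below each occurrence of `x`. -/
theorem Irreducible.of_subst {R : Set (L.Term V × L.Term V)} {t : L.Term V} {σ : Subst L V}
    (h : Irreducible R (t.subst σ)) {x : V} (hx : x ∈ tvars t) : Irreducible R (σ x) := by
  have key : ∀ t' , Rewrites R (σ x) t' → ∃ t'', Rewrites R (t.subst σ) t'' := by
    intro t' ht'
    clear h
    induction t with
    | var y =>
      obtain rfl : x = y := hx
      exact ⟨t', ht'⟩
    | func f ts ih =>
      obtain ⟨i, hi⟩ := Set.mem_iUnion.1 hx
      obtain ⟨t'', e, he, p, τ, h1, -⟩ := ih i hi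
      exact ⟨_, e, he, i :: p, τ, by simpa [subtermAt, Term.subst] using h1, rfl⟩
  intro t' ht'
  obtain ⟨t'', h''⟩ := key t' ht'
  exact h _ h''

/-- The ground instances of a closure can be normalized. -/
theorem exists_normalized_subst (hlt : IsDesiredTermOrdering lt) (Γ : Set (Literal L V))
    (X : Set V) (σ : Subst L V) :
    ∃ τ : Subst L V, IrreducibleSubst (conv lt Γ) τ ∧
      ∀ x ∈ X, IsNormalForm (conv lt Γ) (σ x) (τ x) := by
  classical
  choose nf hnf using exists_isNormalForm hlt Γ
  -- Variables outside `X` are fixed, which `IrreducibleSubst` exempts.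
  refine ⟨fun x => if x ∈ X then nf (σ x) else .var x, fun x hx => ?_, fun x hx => ?_⟩
  · by_cases h : x ∈ X
    · simp only [h, if_true]
      exact (hnf _).2
    · simp [h] at hx
  · simp only [hx, if_true]
    exact hnf _

end Rewriting

/-! ### Literals and clauses: bounds, unifiers, truth, normalization -/

section Literals

variable {L : FirstOrder.Language.{u, v}} {V : Type w} {lt : L.Term V → L.Term V → Prop}
  {β : L.Term V} {Γ Δ : Set (Literal L V)} {K H : Literal L V} {C D : Clause L V}

@[simp] theorem Literal.comp_comp (K : Literal L V) : K.comp.comp = K := by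
  simp [Literal.comp]

theorem Literal.comp_ne (K : Literal L V) : K.comp ≠ K := by
  intro h
  have := congrArg Literal.pos h
  simp [Literal.comp] at this

theorem Literal.mem_toMultiset {t : L.Term V} : t ∈ K.toMultiset ↔ t ∈ K.eqn := by
  unfold Literal.toMultiset
  split <;> simp

theorem litBelow_iff : LitBelow lt β K ↔ ∀ t ∈ K.eqn, lt t β := by
  simp [LitBelow, MulLT.singleton_iff, Literal.mem_toMultiset]

theorem clauseBelow_iff : ClauseBelow lt β C ↔ ∀ K ∈ C, LitBelow lt β K := by
  simp [ClauseBelow, MulLT.singleton_iff, LitBelow]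

theorem LitBelow.comp (h : LitBelow lt β K) : LitBelow lt β K.comp :=
  litBelow_iff.2 fun t ht => litBelow_iff.1 h t ht

theorem LitBelow.not_above (hlt : IsDesiredTermOrdering lt) (h : LitBelow lt β K) :
    ¬ LitAbove lt β K := by
  rintro ⟨X, Y, Z, hZ, hX, hK, hY⟩
  have h' : ∀ t ∈ K.toMultiset, lt t β := fun t ht =>
    litBelow_iff.1 h t (Literal.mem_toMultiset.1 ht)
  rcases singleton_eq_add hX with ⟨rfl, rfl⟩ | ⟨rfl, rfl⟩
  · exact hlt.irrefl _ (h' β (by simp [hK]))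
  · obtain ⟨z, hz, hr⟩ := hY β (by simp)
    exact hlt.wellFounded.asymmetric _ _ hr (h' z (by simp [hK, hz]))

theorem Literal.ground_iff : K.Ground ↔ ∀ t ∈ K.eqn, TGround t := by
  simp only [Literal.Ground, Literal.vars, TGround, Set.eq_empty_iff_forall_notMem,
    Set.mem_ofPred_eq, not_exists, not_and]
  exact ⟨fun h t ht x => h x t ht, fun h x t ht => h t ht x⟩

theorem Clause.ground_iff : Clause.Ground C ↔ ∀ K ∈ C, K.Ground := by
  simp only [Clause.Ground, Clause.vars, Literal.Ground, Set.eq_empty_iff_forall_notMem,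
    Set.mem_ofPred_eq, not_exists, not_and]
  exact ⟨fun h t ht x => h x t ht, fun h x t ht => h t ht x⟩

theorem LitBelow.ground (hlt : IsDesiredTermOrdering lt) (hβ : TGround β)
    (h : LitBelow lt β K) : K.Ground :=
  Literal.ground_iff.2 fun t ht => hlt.ground_of_lt hβ (litBelow_iff.1 h t ht)

theorem Literal.mem_subst {t : L.Term V} {σ : Subst L V} :
    t ∈ (K.subst σ).eqn ↔ ∃ s ∈ K.eqn, s.subst σ = t := by
  simp [Literal.subst, Sym2.mem_map]

theorem Literal.subst_congr {σ τ : Subst L V} (h : ∀ x ∈ K.vars, σ x = τ x) :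
    K.subst σ = K.subst τ := by
  simp only [Literal.subst, Literal.mk.injEq, true_and]
  exact Sym2.map_congr fun t ht => SCLEQ.subst_congr fun x hx => h x ⟨t, ht, hx⟩

theorem Literal.subst_subst (K : Literal L V) (σ τ : Subst L V) :
    (K.subst σ).subst τ = K.subst (Subst.comp σ τ) := by
  simp only [Literal.subst, Sym2.map_map, Literal.mk.injEq, true_and]
  exact Sym2.map_congr fun t _ => SCLEQ.subst_subst t σ τ

theorem Literal.subst_var (K : Literal L V) : K.subst Term.var = K := by
  simp only [Literal.subst]
  simp [SCLEQ.subst_var]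

theorem Clause.mem_subst {σ : Subst L V} : K ∈ Clause.subst C σ ↔ ∃ H ∈ C, H.subst σ = K := by
  simp [Clause.subst]

theorem Clause.subst_add (C D : Clause L V) (σ : Subst L V) :
    Clause.subst (C + D) σ = Clause.subst C σ + Clause.subst D σ := by
  simp [Clause.subst]

@[simp] theorem Clause.subst_singleton (σ : Subst L V) :
    Clause.subst {K} σ = {K.subst σ} := by
  simp [Clause.subst]

theorem Clause.subst_subst (C : Clause L V) (σ τ : Subst L V) :
    Clause.subst (Clause.subst C σ) τ = Clause.subst C (Subst.comp σ τ) := by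
  simp [Clause.subst, Literal.subst_subst]

theorem Clause.subst_var (C : Clause L V) : Clause.subst C Term.var = C := by
  simp [Clause.subst, Literal.subst_var]

/-- With `σ = μρ`, idempotence gives `μσ = μμρ = μρ = σ`. Hence applying `μ` to the clause of a
closure leaves its ground instance unchanged. -/
theorem IsMgu.comp_eq {E : Set (L.Term V × L.Term V)} {μ σ : Subst L V} (h : IsMgu E μ)
    (hσ : Unifies σ E) : Subst.comp μ σ = σ := by
  obtain ⟨ρ, rfl⟩ := h.most_general σ hσ
  funext x
  have := congrFun h.idempotent x
  simp only [Subst.comp] at this ⊢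
  conv_rhs => rw [← this]
  rw [SCLEQ.subst_subst]

theorem IsLitMgu.comp_eq {σ μ : Subst L V} {S : Clause L V} (h : IsLitMgu σ K S μ) :
    Subst.comp μ σ = σ := by
  obtain ⟨s, t, P, -, -, hP, hμ⟩ := h
  refine hμ.comp_eq ?_
  rintro e ⟨q, hq, rfl | rfl⟩
  · exact (hP q hq).1.symm
  · exact (hP q hq).2.symm

/-- Serves the propagations in which no literals are merged. -/
theorem isLitMgu_zero (σ : Subst L V) (K : Literal L V) : IsLitMgu σ K 0 Term.var := by
  obtain ⟨b, e⟩ := K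
  induction e with
  | _ s t =>
    refine ⟨s, t, 0, rfl, by simp, by simp, ?_, ?_, ?_, ?_⟩
    · simp [Unifies]
    · exact fun θ _ => ⟨θ, rfl⟩
    · rfl
    · exact fun x hx => absurd rfl hx

/-! ### Semantics -/

theorem Literal.holds_comp {M : Type*} [L.Structure M] {val : V → M} :
    K.comp.Holds M val ↔ ¬ K.Holds M val := by
  unfold Literal.Holds Literal.comp
  cases K.pos <;> simp

theorem Entails.mono (hs : Γ ⊆ Δ) (h : Entails Γ K) : Entails Δ K :=
  fun M _ val hM => h M val fun H hH => hM H (hs hH)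

theorem Defined.mono (hs : Γ ⊆ Δ) (h : Defined Γ K) : Defined Δ K :=
  h.imp (Entails.mono hs) (Entails.mono hs)

theorem Defined.comp_iff : Defined Γ K.comp ↔ Defined Γ K := by
  simp [Defined, or_comm]

theorem entails_of_mem (h : K ∈ Γ) : Entails Γ K := fun _ _ _ hM => hM K h

theorem BFalse.mono (hs : Γ ⊆ Δ) (h : BFalse lt β Γ K) : BFalse lt β Δ K :=
  ⟨h.1, h.2.mono hs⟩

theorem ClauseBFalse.mono (hs : Γ ⊆ Δ) (h : ClauseBFalse lt β Γ C) : ClauseBFalse lt β Δ C :=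
  fun K hK => (h K hK).mono hs

theorem BFalse.not_bUndef (hlt : IsDesiredTermOrdering lt) (h : BFalse lt β Γ K) :
    ¬ BUndef lt β Γ K := by
  rintro (h' | h')
  · exact h.1.not_above hlt h'
  · exact h' (.inr h.2)

theorem ClauseBFalse.ground (hlt : IsDesiredTermOrdering lt) (hβ : TGround β)
    (h : ClauseBFalse lt β Γ C) : Clause.Ground C :=
  Clause.ground_iff.2 fun K hK => (h K hK).1.ground hlt hβ

/-- Two literals with the same truth value in all models of `Γ`. -/
def LitEquiv (Γ : Set (Literal L V)) (K H : Literal L V) : Prop :=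
  ∀ (M : Type (max u w)) [L.Structure M] (val : V → M), Models Γ M val →
    (K.Holds M val ↔ H.Holds M val)

theorem LitEquiv.comp (h : LitEquiv Γ K H) : LitEquiv Γ K.comp H.comp :=
  fun M _ val hM => by rw [Literal.holds_comp, Literal.holds_comp, h M val hM]

theorem LitEquiv.entails (h : LitEquiv Γ K H) : Entails Γ K ↔ Entails Γ H :=
  ⟨fun h' M _ val hM => (h M val hM).1 (h' M val hM),
    fun h' M _ val hM => (h M val hM).2 (h' M val hM)⟩

theorem LitEquiv.defined (h : LitEquiv Γ K H) : Defined Γ K ↔ Defined Γ H :=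
  or_congr h.entails h.comp.entails

theorem IsLitNormalForm.litEquiv (hlt : IsDesiredTermOrdering lt)
    (h : IsLitNormalForm (conv lt Γ) K H) : LitEquiv Γ K H := by
  obtain ⟨s, t, s', t', hK, rfl, hs, ht⟩ := h
  intro M _ val hM
  rw [hK]
  simp [Literal.Holds, (reflTransGen_rewrites hlt hs.1).2 M val hM,
    (reflTransGen_rewrites hlt ht.1).2 M val hM]

theorem IsLitNormalForm.litBelow (hlt : IsDesiredTermOrdering lt)
    (h : IsLitNormalForm (conv lt Γ) K H) (hK : LitBelow lt β K) : LitBelow lt β H := by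
  obtain ⟨s, t, s', t', e, rfl, hs, ht⟩ := h
  rw [e] at hK
  rw [litBelow_iff] at hK ⊢
  simp only [Sym2.mem_iff, forall_eq_or_imp, forall_eq] at hK ⊢
  constructor
  · rcases (reflTransGen_rewrites hlt hs.1).1 with rfl | h
    · exact hK.1
    · exact hlt.trans _ _ _ h hK.1
  · rcases (reflTransGen_rewrites hlt ht.1).1 with rfl | h
    · exact hK.2
    · exact hlt.trans _ _ _ h hK.2

theorem IsLitNormalForm.irreducible {R : Set (L.Term V × L.Term V)}
    (h : IsLitNormalForm R K H) : ∀ t ∈ H.eqn, Irreducible R t := by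
  obtain ⟨s, t, s', t', e, rfl, hs, ht⟩ := h
  simp only [Sym2.mem_iff, forall_eq_or_imp, forall_eq]
  exact ⟨hs.2, ht.2⟩

theorem isLitNormalForm_self {R : Set (L.Term V × L.Term V)}
    (h : ∀ t ∈ K.eqn, Irreducible R t) : IsLitNormalForm R K K := by
  obtain ⟨b, e⟩ := K
  induction e with
  | _ s t =>
    simp only [Sym2.mem_iff, forall_eq_or_imp, forall_eq] at h
    exact ⟨s, t, s, t, rfl, rfl, ⟨.refl, h.1⟩, ⟨.refl, h.2⟩⟩

theorem LitBelow.normalize (hlt : IsDesiredTermOrdering lt) {σ τ : Subst L V}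
    (h : ∀ x ∈ K.vars, IsNormalForm (conv lt Γ) (σ x) (τ x)) (hK : LitBelow lt β (K.subst σ)) :
    LitBelow lt β (K.subst τ) := by
  rw [litBelow_iff] at hK ⊢
  intro t ht
  obtain ⟨s, hs, rfl⟩ := Literal.mem_subst.1 ht
  have hb := hK _ (Literal.mem_subst.2 ⟨s, hs, rfl⟩)
  rcases hlt.subst_le s (σ := σ) (τ := τ) fun x hx =>
    (reflTransGen_rewrites hlt (h x ⟨s, hs, hx⟩).1).1 with e | e
  · exact e ▸ hb
  · exact hlt.trans _ _ _ e hb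

theorem LitEquiv.normalize (hlt : IsDesiredTermOrdering lt) {σ τ : Subst L V}
    (h : ∀ x ∈ K.vars, IsNormalForm (conv lt Γ) (σ x) (τ x)) :
    LitEquiv Γ (K.subst σ) (K.subst τ) := by
  intro M _ val hM
  have key : ∀ t ∈ K.eqn, (t.subst σ).realize val = (t.subst τ).realize val := by
    intro t ht
    have hv : ∀ x ∈ tvars t, (τ x).realize val = (σ x).realize val := fun x hx =>
      (reflTransGen_rewrites hlt (h x ⟨t, ht, hx⟩).1).2 M val hM
    clear ht h
    induction t with
    | var x => exact (hv x rfl).symm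
    | func f ts ih =>
      simp only [Term.subst, Term.realize_func]
      congr 1
      funext i
      exact ih i fun x hx => hv x (Set.mem_iUnion.2 ⟨i, hx⟩)
  simp only [Literal.Holds, Literal.subst, Sym2.map_map]
  have e : Sym2.map ((fun t => Term.realize val t) ∘ fun t => t.subst σ) K.eqn =
      Sym2.map ((fun t => Term.realize val t) ∘ fun t => t.subst τ) K.eqn :=
    Sym2.map_congr fun t ht => key t ht
  rw [e]

/-- Normal forms are smaller or equal and have the same values in all models of `Γ`. This supplies
the irreducible groundings that Conflict and Propagate demand. -/
theorem BFalse.normalize (hlt : IsDesiredTermOrdering lt) {σ τ : Subst L V}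
    (h : ∀ x ∈ K.vars, IsNormalForm (conv lt Γ) (σ x) (τ x)) (hK : BFalse lt β Γ (K.subst σ)) :
    BFalse lt β Γ (K.subst τ) :=
  ⟨hK.1.normalize hlt h, (LitEquiv.normalize hlt h).comp.entails.1 hK.2⟩

/-- Both sides lie below a ground term and are therefore ground, so `finite_below` bounds them. -/
theorem finite_litBelow (hlt : IsDesiredTermOrdering lt) (hβ : TGround β) :
    {K : Literal L V | LitBelow lt β K}.Finite := by
  have h1 := hlt.finite_below β hβ
  have h2 : ((fun q : Bool × L.Term V × L.Term V => (⟨q.1, s(q.2.1, q.2.2)⟩ : Literal L V)) ''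
    (Set.univ ×ˢ ({s | TGround s ∧ lt s β} ×ˢ {s | TGround s ∧ lt s β}))).Finite :=
    (Set.finite_univ.prod (h1.prod h1)).image _
  refine h2.subset ?_
  rintro ⟨b, e⟩ hK
  induction e with
  | _ s t =>
    have hK := litBelow_iff.1 hK
    simp only [Sym2.mem_iff, forall_eq_or_imp, forall_eq] at hK
    exact ⟨(b, s, t), ⟨trivial, ⟨hlt.ground_of_lt hβ hK.1, hK.1⟩,
      hlt.ground_of_lt hβ hK.2, hK.2⟩, rfl⟩

end Literals

/-! ### Sound trails, levels and the ordering `≺_{Γ*}` -/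

section Trails

variable {L : FirstOrder.Language.{u, v}} {V : Type w} {lt : L.Term V → L.Term V → Prop}
  {β : L.Term V} {Γ Δ Ξ : Trail L V} {a b : AnnLit L V} {K H : Literal L V}

theorem Trail.mem_lits : K ∈ Trail.lits Γ ↔ ∃ a ∈ Γ, a.lit = K := Iff.rfl

theorem Trail.lits_append_singleton (Γ : Trail L V) (a : AnnLit L V) :
    Trail.lits (Γ ++ [a]) = insert a.lit (Trail.lits Γ) := by
  ext K
  simp only [Trail.mem_lits, List.mem_append, List.mem_singleton, Set.mem_insert_iff]
  constructor
  · rintro ⟨b, hb | rfl, rfl⟩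
    · exact .inr ⟨b, hb, rfl⟩
    · exact .inl rfl
  · rintro (rfl | ⟨b, hb, rfl⟩)
    · exact ⟨a, .inr rfl, rfl⟩
    · exact ⟨b, .inl hb, rfl⟩

/-- The trail literals are below `β`, and undefined in the trail before them. -/
def Trail.Sound (lt : L.Term V → L.Term V → Prop) (β : L.Term V) (Γ : Trail L V) : Prop :=
  ∀ (Δ : Trail L V) (a : AnnLit L V) (Ξ : Trail L V), Γ = Δ ++ a :: Ξ →
    LitBelow lt β a.lit ∧ ¬ Defined (Trail.lits Δ) a.lit

theorem Trail.sound_nil : Trail.Sound lt β ([] : Trail L V) := by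
  intro Δ a Ξ h
  simp at h

theorem Trail.Sound.of_append (h : Trail.Sound lt β (Γ ++ Δ)) : Trail.Sound lt β Γ := by
  rintro Δ' a Ξ rfl
  exact h Δ' a (Ξ ++ Δ) (by simp)

theorem split_append_singleton {α : Type*} {l l₁ l₂ : List α} {a b : α}
    (h : l ++ [a] = l₁ ++ b :: l₂) : (l = l₁ ∧ a = b) ∨ ∃ l₃, l = l₁ ++ b :: l₃ := by
  rcases List.eq_nil_or_concat l₂ with rfl | ⟨l₃, c, rfl⟩
  · obtain ⟨h1, h2⟩ := List.append_inj' h rfl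
    exact .inl ⟨h1, by simpa using h2⟩
  · right
    refine ⟨l₃, ?_⟩
    have : l ++ [a] = (l₁ ++ b :: l₃) ++ [c] := by simpa using h
    exact (List.append_inj' this rfl).1

theorem Trail.Sound.append_singleton (h : Trail.Sound lt β Γ) (ha : LitBelow lt β a.lit)
    (hu : ¬ Defined (Trail.lits Γ) a.lit) : Trail.Sound lt β (Γ ++ [a]) := by
  intro Δ b Ξ e
  rcases split_append_singleton e with ⟨rfl, rfl⟩ | ⟨Ξ', e'⟩
  · exact ⟨ha, hu⟩
  · exact h Δ b Ξ' e'

theorem Trail.eq_take_append_drop (Γ : Trail L V) (i : Fin (List.length Γ)) :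
    Γ = List.take i Γ ++ List.get Γ i :: List.drop (i + 1) Γ := by
  conv_lhs => rw [← List.take_append_drop i Γ, List.drop_eq_getElem_cons i.2]
  rfl

theorem Trail.Sound.not_defined_of_lt (h : Trail.Sound lt β Γ) {i j : Fin (List.length Γ)}
    (hij : i < j) : (List.get Γ j).lit ≠ (List.get Γ i).lit ∧
      (List.get Γ j).lit ≠ (List.get Γ i).lit.comp := by
  have hj := (h _ _ _ (Trail.eq_take_append_drop Γ j)).2
  have hi : (List.get Γ i).lit ∈ Trail.lits (List.take j Γ) :=
    ⟨_, List.mem_take_iff_getElem.2 ⟨i, by simpa using hij, rfl⟩, rfl⟩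
  have hd : Defined (Trail.lits (List.take j Γ)) (List.get Γ i).lit := .inl (entails_of_mem hi)
  exact ⟨fun e => hj (e ▸ hd), fun e => hj (e ▸ Defined.comp_iff.2 hd)⟩

theorem Trail.Sound.get_injective (h : Trail.Sound lt β Γ) {i j : Fin (List.length Γ)}
    (e : (List.get Γ i).lit = (List.get Γ j).lit) : i = j := by
  rcases lt_trichotomy i j with hij | hij | hij
  · exact absurd e.symm (h.not_defined_of_lt hij).1
  · exact hij
  · exact absurd e (h.not_defined_of_lt hij).1

theorem Trail.Sound.get_ne_comp (h : Trail.Sound lt β Γ) (i j : Fin (List.length Γ)) :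
    (List.get Γ i).lit ≠ (List.get Γ j).lit.comp := by
  intro e
  rcases lt_trichotomy i j with hij | rfl | hij
  · exact (h.not_defined_of_lt hij).2 (by rw [e, Literal.comp_comp])
  · exact Literal.comp_ne _ e.symm
  · exact (h.not_defined_of_lt hij).2 e

/-- Being undefined in the preceding prefix makes the trail literals pairwise distinct. -/
theorem Trail.Sound.length_le (hlt : IsDesiredTermOrdering lt) (hβ : TGround β)
    (h : Trail.Sound lt β Γ) : List.length Γ ≤ {K : Literal L V | LitBelow lt β K}.ncard := by
  have := (finite_litBelow hlt hβ).to_subtype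
  have key := Nat.card_le_card_of_injective
    (fun i : Fin (List.length Γ) => (⟨(List.get Γ i).lit,
      (h _ _ _ (Trail.eq_take_append_drop Γ i)).1⟩ : {K : Literal L V | LitBelow lt β K}))
    fun i j e => h.get_injective (congrArg Subtype.val e)
  rw [Nat.card_fin, Nat.card_coe_set_eq] at key
  exact key

/-! ### Cores and levels -/

theorem exists_isCore (h : Defined (Trail.lits Γ) K) : ∃ I, IsCore Γ K I := by
  obtain ⟨I, hI, hmin⟩ := (wellFounded_lt (α := Finset (Fin (List.length Γ)))).has_min
    {I | Defined (Trail.litsAt Γ I) K} ⟨Finset.univ, h.mono (by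
      rintro H ⟨a, ha, rfl⟩
      obtain ⟨i, rfl⟩ := List.get_of_mem ha
      exact ⟨i, Finset.mem_univ _, rfl⟩)⟩
  exact ⟨I, hI, fun J hJ hd => hmin J hd hJ⟩

/-- By `h0` no core is empty, so each core has a rightmost literal; the least of their indices is
the one sought. -/
theorem exists_isDefiningIndex (h : Defined (Trail.lits Γ) K) (h0 : ¬ Defined ∅ K) :
    ∃ i, IsDefiningIndex Γ K i := by
  have hmax : ∀ J, IsCore Γ K J → ∃ j ∈ J, ∀ i ∈ J, i ≤ j := by
    intro J hJ
    have hne : J.Nonempty := by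
      rw [Finset.nonempty_iff_ne_empty]
      rintro rfl
      refine h0 (hJ.1.mono ?_)
      rintro H ⟨i, hi, -⟩
      simp at hi
    exact ⟨J.max' hne, J.max'_mem hne, fun i hi => J.le_max' i hi⟩
  obtain ⟨I, hI⟩ := exists_isCore h
  obtain ⟨m, hm⟩ := hmax I hI
  obtain ⟨i, hi, hmin⟩ := (wellFounded_lt (α := Fin (List.length Γ))).has_min
    {i | ∃ I, IsCore Γ K I ∧ i ∈ I ∧ ∀ j ∈ I, j ≤ i} ⟨m, I, hI, hm⟩
  refine ⟨i, hi, fun J hJ => ?_⟩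
  obtain ⟨j, hj, hj'⟩ := hmax J hJ
  exact ⟨j, hj, not_lt.1 (hmin j ⟨J, hJ, hj, hj'⟩)⟩

theorem IsDefiningIndex.unique {i j : Fin (List.length Γ)} (hi : IsDefiningIndex Γ K i)
    (hj : IsDefiningIndex Γ K j) : i = j := by
  obtain ⟨⟨I, hI, -, hI'⟩, hi⟩ := hi
  obtain ⟨⟨J, hJ, -, hJ'⟩, hj⟩ := hj
  obtain ⟨x, hx, hix⟩ := hi J hJ
  obtain ⟨y, hy, hjy⟩ := hj I hI
  exact le_antisymm (hix.trans (hJ' x hx)) (hjy.trans (hI' y hy))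

/-- A literal whose level is below that of the last trail literal is defined without it. -/
theorem defined_of_litLevel_lt (h : Defined (Trail.lits (Γ ++ [a])) K)
    (hl : litLevel (Γ ++ [a]) K < a.level) : Defined (Trail.lits Γ) K := by
  -- In this case the only core is empty and there is no defining literal.
  by_cases h0 : Defined ∅ K
  · exact h0.mono (Set.empty_subset _)
  unfold litLevel at hl
  split at hl
  · rename_i hex
    obtain ⟨hm, he⟩ := hex.choose_spec
    rcases List.mem_append.1 hm with hm | hm
    · exact .inl (entails_of_mem ⟨_, hm, he⟩)
    · rw [List.mem_singleton.1 hm] at hl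
      exact absurd hl (lt_irrefl _)
  · have hex := exists_isDefiningIndex h h0
    rw [dif_pos hex] at hl
    obtain ⟨⟨I, hI, -, hmax⟩, -⟩ := hex.choose_spec
    -- Were `a` the defining literal, `K` would have the level of `a`. So the whole core lies in
    -- `Γ`.
    have hlast : ((hex.choose : Fin _) : ℕ) < Γ.length := by
      by_contra hc
      have hlt := hex.choose.2
      have e : ((hex.choose : Fin _) : ℕ) = Γ.length := by
        simp only [List.length_append, List.length_singleton] at hlt
        omega
      have : List.get (Γ ++ [a]) hex.choose = a := by
        simp [List.get_eq_getElem, e]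
      rw [this] at hl
      exact absurd hl (lt_irrefl _)
    refine hI.1.mono ?_
    rintro H ⟨i, hi, rfl⟩
    have hi' : (i : ℕ) < Γ.length := lt_of_le_of_lt (hmax i hi) hlast
    refine ⟨Γ[(i : ℕ)], List.getElem_mem _, ?_⟩
    simp [List.get_eq_getElem, List.getElem_append_left hi']

theorem litLevel_le_clauseLevel {C : Clause L V} (h : K ∈ C) :
    litLevel Γ K ≤ clauseLevel Γ C :=
  Multiset.le_sup (Multiset.mem_map_of_mem _ h)

/-! ### The trail induced ordering is well-founded on defined literals -/

open Classical in
/-- The position of a defined literal in the trail induced ordering: level `0` or not, defining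
literal, kind of literal, and the literal itself. -/
noncomputable def trailKey (Γ : Trail L V) (K : Literal L V) :
    ℕ × ℕ × ℕ × Multiset (L.Term V) :=
  if litLevel Γ K = 0 then (0, 0, 0, K.toMultiset)
  else if h : ∃ i : Fin (List.length Γ), (List.get Γ i).lit = K then (1, h.choose, 0, K.toMultiset)
  else if h : ∃ i : Fin (List.length Γ), (List.get Γ i).lit.comp = K then
    (1, h.choose, 1, K.toMultiset)
  else if h : ∃ i, IsDefiningIndex Γ K i then (1, h.choose, 2, K.toMultiset)
  -- Never reached: a positive level comes from membership in the trail or from a defining literal.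
  else (1, 0, 0, K.toMultiset)

theorem trailKey_zero (h : litLevel Γ K = 0) : trailKey Γ K = (0, 0, 0, K.toMultiset) := by
  simp [trailKey, h]

theorem trailKey_get (hΓ : Trail.Sound lt β Γ) (i : Fin (List.length Γ))
    (h : 0 < litLevel Γ (List.get Γ i).lit) :
    trailKey Γ (List.get Γ i).lit = (1, ↑i, 0, (List.get Γ i).lit.toMultiset) := by
  have hex : ∃ j : Fin (List.length Γ), (List.get Γ j).lit = (List.get Γ i).lit := ⟨i, rfl⟩
  rw [trailKey, if_neg h.ne', dif_pos hex, hΓ.get_injective hex.choose_spec]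

theorem trailKey_get_comp (hΓ : Trail.Sound lt β Γ) (i : Fin (List.length Γ))
    (h : 0 < litLevel Γ (List.get Γ i).lit.comp) :
    trailKey Γ (List.get Γ i).lit.comp = (1, ↑i, 1, (List.get Γ i).lit.comp.toMultiset) := by
  have hex : ∃ j : Fin (List.length Γ), (List.get Γ j).lit.comp = (List.get Γ i).lit.comp :=
    ⟨i, rfl⟩
  have hne : ¬ ∃ j : Fin (List.length Γ), (List.get Γ j).lit = (List.get Γ i).lit.comp :=
    fun ⟨j, hj⟩ => hΓ.get_ne_comp j i hj
  have hi : hex.choose = i := hΓ.get_injective (by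
    have := congrArg Literal.comp hex.choose_spec
    rwa [Literal.comp_comp, Literal.comp_comp] at this)
  rw [trailKey, if_neg h.ne', dif_neg hne, dif_pos hex, hi]

theorem trailKey_isMLit {i : Fin (List.length Γ)} (hK : IsMLit lt β Γ i K)
    (h : 0 < litLevel Γ K) : trailKey Γ K = (1, ↑i, 2, K.toMultiset) := by
  obtain ⟨-, h1, h2, hi⟩ := hK
  have hex : ∃ i, IsDefiningIndex Γ K i := ⟨i, hi⟩
  rw [trailKey, if_neg h.ne', dif_neg, dif_neg, dif_pos hex, hex.choose_spec.unique hi]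
  · rintro ⟨j, rfl⟩
    exact h2 ⟨_, List.get_mem Γ j, by simp⟩
  · rintro ⟨j, rfl⟩
    exact h1 ⟨_, List.get_mem Γ j, rfl⟩

theorem trailKey_of_pos (h : 0 < litLevel Γ K) : (trailKey Γ K).1 = 1 := by
  unfold trailKey
  rw [if_neg h.ne']
  split_ifs <;> rfl

/-- Soundness makes the index of a trail literal unique, so the keys can be computed and each rule
of the ordering is an instance of lexicographic descent. The two rules for undefined literals are
excluded by the assumption on the larger literal `H` alone. -/
theorem TrailLT.trailKey_lt (hΓ : Trail.Sound lt β Γ) (h : TrailLT lt β Γ K H)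
    (hH' : ¬ BUndef lt β (Trail.lits Γ) H) :
    Prod.Lex (· < ·) (Prod.Lex (· < ·) (Prod.Lex (· < ·) (MulLT lt)))
      (trailKey Γ K) (trailKey Γ H) := by
  obtain ⟨-, -, h⟩ := h
  cases h with
  | m_m_lt hK hH lK lH h =>
    rw [trailKey_isMLit hK lK, trailKey_isMLit hH lH]
    exact .right _ (.left _ _ h)
  | m_m_eq hK hH lK lH h =>
    rw [trailKey_isMLit hK lK, trailKey_isMLit hH lH]
    exact .right _ (.right _ (.right _ h))
  | l_l li lj h =>
    rw [trailKey_get hΓ _ li, trailKey_get hΓ _ lj]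
    exact .right _ (.left _ _ h)
  | c_l li lj h =>
    rw [trailKey_get_comp hΓ _ li, trailKey_get hΓ _ lj]
    exact .right _ (.left _ _ h)
  | l_c li lj h =>
    rw [trailKey_get hΓ _ li, trailKey_get_comp hΓ _ lj]
    rcases h.lt_or_eq with h | rfl
    · exact .right _ (.left _ _ h)
    · exact .right _ (.right _ (.left _ _ one_pos))
  | c_c li lj h =>
    rw [trailKey_get_comp hΓ _ li, trailKey_get_comp hΓ _ lj]
    exact .right _ (.left _ _ h)
  | l_m hH li lH h =>
    rw [trailKey_get hΓ _ li, trailKey_isMLit hH lH]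
    rcases h.lt_or_eq with h | rfl
    · exact .right _ (.left _ _ h)
    · exact .right _ (.right _ (.left _ _ two_pos))
  | c_m hH li lH h =>
    rw [trailKey_get_comp hΓ _ li, trailKey_isMLit hH lH]
    rcases h.lt_or_eq with h | rfl
    · exact .right _ (.left _ _ h)
    · exact .right _ (.right _ (.left _ _ one_lt_two))
  | m_l hK lK li h =>
    rw [trailKey_isMLit hK lK, trailKey_get hΓ _ li]
    exact .right _ (.left _ _ h)
  | m_c hK lK li h =>
    rw [trailKey_isMLit hK lK, trailKey_get_comp hΓ _ li]
    exact .right _ (.left _ _ h)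
  | zero_zero hK hH lK lH h =>
    rw [trailKey_zero lK, trailKey_zero lH]
    exact .right _ (.right _ (.right _ h))
  | zero_pos hK hH lK lH =>
    refine Prod.lex_def.2 (.inl ?_)
    rw [trailKey_zero lK, trailKey_of_pos lH]
    exact one_pos
  | undef_undef hK hH h => exact absurd hH hH'
  | def_undef hK hH => exact absurd hH hH'

/-- The multiset extension of the trail induced ordering is well-founded on `β`-false clauses. -/
theorem wellFounded_trailLT (hlt : IsDesiredTermOrdering lt) (hΓ : Trail.Sound lt β Γ) :
    WellFounded fun C D : Clause L V => MulLT (TrailLT lt β Γ) C D ∧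
      ClauseBFalse lt β (Trail.lits Γ) D := by
  have hwf : WellFounded (Prod.Lex (· < ·) (Prod.Lex (· < ·) (Prod.Lex (· < ·) (MulLT lt))) :
      ℕ × ℕ × ℕ × Multiset (L.Term V) → ℕ × ℕ × ℕ × Multiset (L.Term V) → Prop) :=
    wellFounded_lt.prod_lex (wellFounded_lt.prod_lex
      (wellFounded_lt.prod_lex (wellFounded_mulLT hlt.wellFounded)))
  refine Subrelation.wf ?_ (wellFounded_mulLT (InvImage.wf (trailKey Γ) hwf))
  rintro C D ⟨⟨X, Y, Z, hZ, rfl, rfl, h⟩, hD⟩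
  refine ⟨X, Y, Z, hZ, rfl, rfl, fun y hy => ?_⟩
  obtain ⟨z, hz, hr⟩ := h y hy
  -- Only the removed literals need to be defined, and they belong to the `β`-false clause.
  exact ⟨z, hz, hr.trailKey_lt hΓ
    ((hD z (Multiset.mem_add.2 (.inr hz))).not_bUndef hlt)⟩

end Trails

/-! ### Effects of the rules, invariants, and novelty of learned clauses -/

section Steps

variable {L : FirstOrder.Language.{u, v}} {V : Type w} {lt : L.Term V → L.Term V → Prop}
  {β : L.Term V} {S T : State L V} {r : Rule}

/-- Some ground instance of a clause in `M` is `β`-false in `Γ`. -/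
def HasFalseInstance (lt : L.Term V → L.Term V → Prop) (β : L.Term V) (M : Set (Clause L V))
    (Γ : Set (Literal L V)) : Prop :=
  ∃ C ∈ M, ∃ τ : Subst L V, ClauseBFalse lt β Γ (Clause.subst C τ)

theorem HasFalseInstance.mono {M M' : Set (Clause L V)} {Γ Γ' : Set (Literal L V)}
    (hM : M ⊆ M') (hΓ : Γ ⊆ Γ') (h : HasFalseInstance lt β M Γ) :
    HasFalseInstance lt β M' Γ' := by
  obtain ⟨C, hC, τ, hτ⟩ := h
  exact ⟨C, hM hC, τ, hτ.mono hΓ⟩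

/-- The given instance may be reducible; normalizing its substitution keeps it `β`-false, and being
below `β` makes it ground. -/
theorem HasFalseInstance.applicable_conflict (hlt : IsDesiredTermOrdering lt)
    (hβ : TGround S.β) (hS : S.status = .top)
    (h : HasFalseInstance lt S.β (S.N ∪ S.U) (Trail.lits S.trail)) :
    Applicable lt .conflict S := by
  obtain ⟨C, hC, τ, hτ⟩ := h
  obtain ⟨τ', h1, h2⟩ := exists_normalized_subst hlt (Trail.lits S.trail) (Clause.vars C) τ
  have hf : ClauseBFalse lt S.β (Trail.lits S.trail) (Clause.subst C τ') := by
    intro K hK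
    obtain ⟨H, hH, rfl⟩ := Clause.mem_subst.1 hK
    exact (hτ _ (Clause.mem_subst.2 ⟨H, hH, rfl⟩)).normalize hlt fun x hx => h2 x ⟨H, hH, hx⟩
  exact ⟨_, hS, C, τ', hC, hf.ground hlt hβ, hf, h1, rfl⟩

/-- The appended literal is a normal form of an undefined literal below `β`. It is no larger and is
equivalent to it in all models of the trail, so both properties carry over. -/
theorem PropagateStep.spec (hlt : IsDesiredTermOrdering lt) {a : AnnLit L V}
    (h : PropagateStep lt S T a) : S.status = .top ∧ LitBelow lt S.β a.lit ∧
      ¬ Defined (Trail.lits S.trail) a.lit ∧ T = { S with trail := S.trail ++ [a] } := by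
  obtain ⟨hS, C₀, C₁, K, σ, μ, P, I, -, -, -, -, hμ, hu, hb, -, ⟨⟨-, I', hI', hn⟩, -⟩, hI, rfl, rfl⟩
    := h
  obtain rfl : I' = I := Option.some.inj (hI'.symm.trans hI)
  have hn' : IsLitNormalForm (conv lt (Trail.lits S.trail)) (K.subst σ)
      (I'.lead.subst I'.sub) := by
    have e : (K.subst μ).subst σ = K.subst σ := by rw [Literal.subst_subst, hμ.comp_eq]
    rw [← e]
    exact hn
  have hK : LitBelow lt S.β (K.subst σ) := by
    refine clauseBelow_iff.1 hb _ ?_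
    rw [Clause.subst_subst, hμ.comp_eq]
    exact Clause.mem_subst.2 ⟨K, by simp, rfl⟩
  refine ⟨hS, hn'.litBelow hlt hK, ?_, rfl⟩
  have hd := hu.resolve_left (hK.not_above hlt)
  exact fun hd' => hd ((hn'.litEquiv hlt).defined.2 hd')

theorem DecideStep.spec (hlt : IsDesiredTermOrdering lt) {a : AnnLit L V}
    (h : DecideStep lt S T a) : S.status = .top ∧ LitBelow lt S.β a.lit ∧
      ¬ Defined (Trail.lits S.trail) a.lit ∧
      (∀ t ∈ a.lit.eqn, Irreducible (conv lt (Trail.lits S.trail)) t) ∧ a.level = S.k + 1 ∧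
      T = { S with trail := S.trail ++ [a], k := S.k + 1 } := by
  obtain ⟨hS, C₀, K, σ, P, I, -, -, -, hu, hb, -, ⟨⟨-, I', hI', hn⟩, -⟩, hI, rfl, rfl⟩ := h
  obtain rfl : I' = I := Option.some.inj (hI'.symm.trans hI)
  have hK : LitBelow lt S.β (K.subst σ) :=
    clauseBelow_iff.1 hb _ (Clause.mem_subst.2 ⟨K, by simp, rfl⟩)
  refine ⟨hS, hn.litBelow hlt hK, ?_, hn.irreducible, rfl, rfl⟩
  have hd := hu.resolve_left (hK.not_above hlt)
  exact fun hd' => hd ((hn.litEquiv hlt).defined.2 hd')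

/-- What the rules other than Grow do, as far as termination is concerned. -/
inductive StepKind (lt : L.Term V → L.Term V → Prop) (r : Rule) (S T : State L V) : Prop
  | extend (a : AnnLit L V) (k : ℕ) (hr : r = .propagate ∨ r = .decide) (hS : S.status = .top)
      (hb : LitBelow lt S.β a.lit) (hu : ¬ Defined (Trail.lits S.trail) a.lit)
      (hT : T = { S with trail := S.trail ++ [a], k := k })
  | conflict (st : Status L V) (hr : r = .conflict) (hS : S.status = .top) (hst : st ≠ .top)
      (hf : ∀ D σ, st = .conflict D σ →
        ClauseBFalse lt S.β (Trail.lits S.trail) (Clause.subst D σ))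
      (hT : T = { S with status := st })
  | skip (Γ : Trail L V) (b : AnnLit L V) (k : ℕ) (D : Clause L V) (σ : Subst L V)
      (hr : r = .skip) (hΓ : S.trail = Γ ++ [b]) (hS : S.status = .conflict D σ)
      (hf : ClauseBFalse lt S.β (Trail.lits Γ) (Clause.subst D σ))
      (hT : T = { S with trail := Γ, k := k })
  | simplify (D D' : Clause L V) (σ σ' : Subst L V)
      (hr : r ≠ .conflict ∧ r ≠ .skip ∧ r ≠ .backtrack) (hS : S.status = .conflict D σ)
      (hf : ClauseBFalse lt S.β (Trail.lits S.trail) (Clause.subst D σ) →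
        ClauseBFalse lt S.β (Trail.lits S.trail) (Clause.subst D' σ'))
      (hlt : MulLT (TrailLT lt S.β S.trail) (Clause.subst D' σ') (Clause.subst D σ))
      (hT : T = { S with status := .conflict D' σ' })
  | backtrack (Γ Γ' : Trail L V) (a : AnnLit L V) (D : Clause L V) (σ : Subst L V) (k : ℕ)
      (hr : r = .backtrack) (hΓ : S.trail = Γ ++ a :: Γ') (hS : S.status = .conflict D σ)
      (hmin : ∀ (Δ Δ' : Trail L V) (b : AnnLit L V), S.trail = Δ ++ b :: Δ' →
        BecomesFalse lt S.β Δ b D → List.length Γ ≤ List.length Δ)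
      (hT : T = { S with trail := Γ, U := S.U ∪ {D}, k := k, status := .top })

theorem MulLT.self_add {α : Type*} {r : α → α → Prop} {M Z : Multiset α} (hZ : Z ≠ 0) :
    MulLT r M (M + Z) := ⟨M, 0, Z, hZ, by simp, rfl, by simp⟩

/-- Explore-Refutation decreases the conflict clause by its side condition. Factorize and
Equality-Resolution only delete a ground literal, because `μσ = σ`. -/
theorem Step.kind (hlt : IsDesiredTermOrdering lt) (h : Step lt r S T) (hr : r ≠ .grow) :
    StepKind lt r S T := by
  cases r with
  | propagate =>
    obtain ⟨a, ha⟩ := h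
    obtain ⟨h1, h2, h3, rfl⟩ := ha.spec hlt
    exact .extend a S.k (.inl rfl) h1 h2 h3 rfl
  | decide =>
    obtain ⟨a, ha⟩ := h
    obtain ⟨h1, h2, h3, -, -, rfl⟩ := ha.spec hlt
    exact .extend a _ (.inr rfl) h1 h2 h3 rfl
  | conflict =>
    obtain ⟨hS, D, σ, -, -, hf, -, rfl⟩ := h
    refine .conflict _ rfl hS ?_ ?_ rfl
    · split <;> simp
    · intro D' σ' e
      split at e
      · cases e
      · cases e
        exact hf
  | skip =>
    obtain ⟨Γ, a, b, D, σ, hΓ, hS, hf, rfl⟩ := h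
    exact .skip (Γ ++ [a]) b _ D σ rfl (by simp [hΓ]) hS hf rfl
  | exploreRefutation =>
    obtain ⟨D, K, σ, i, P, I, hS, -, -, -, -, -, hl, hf, rfl⟩ := h
    exact .simplify _ _ _ _ (by simp) hS (fun _ => hf) hl rfl
  | factorize =>
    obtain ⟨D, K, K', σ, μ, hS, -, hμ, rfl⟩ := h
    have e : Clause.subst (Clause.subst (D + {K}) μ) σ = Clause.subst (D + {K}) σ := by
      rw [Clause.subst_subst, hμ.comp_eq]
    refine .simplify _ _ _ _ (by simp) hS (fun hf H hH => ?_) ?_ rfl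
    · rw [e] at hH
      exact hf H (by rw [Clause.subst_add]; exact Multiset.mem_add.2 (.inl hH))
    · rw [e, Clause.subst_add _ {K'}]
      exact .self_add (by simp)
  | equalityResolution =>
    obtain ⟨D, s, s', σ, μ, hS, hσ, hμ, rfl⟩ := h
    have e : Clause.subst (Clause.subst D μ) σ = Clause.subst D σ := by
      rw [Clause.subst_subst, hμ.comp_eq]
      rintro _ rfl
      exact hσ
    refine .simplify _ _ _ _ (by simp) hS (fun hf H hH => ?_) ?_ rfl
    · rw [e] at hH
      exact hf H (by rw [Clause.subst_add]; exact Multiset.mem_add.2 (.inl hH))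
    · rw [e, Clause.subst_add D]
      exact .self_add (by simp)
  | backtrack =>
    obtain ⟨Γ, Γ', a, D, K, σ, hΓ, hS, -, -, hmin, rfl⟩ := h
    refine .backtrack Γ Γ' a _ _ _ rfl (by simp [hΓ]) hS (fun Δ Δ' b e => ?_) rfl
    exact hmin Δ Δ' b (by simp [e])
  | grow => exact absurd rfl hr

/-- The basic invariant: the trail is sound and a conflict closure is `β`-false. -/
structure State.Inv (lt : L.Term V → L.Term V → Prop) (S : State L V) : Prop where
  ground : TGround S.β
  sound : Trail.Sound lt S.β S.trail
  conflict_false : ∀ D σ, S.status = .conflict D σ →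
    ClauseBFalse lt S.β (Trail.lits S.trail) (Clause.subst D σ)

theorem StepKind.inv (h : StepKind lt r S T) (hS : S.Inv lt) : T.Inv lt := by
  cases h with
  | extend a k hr hst hb hu hT =>
    subst hT
    exact ⟨hS.ground, hS.sound.append_singleton hb hu, fun D σ e => by simp [hst] at e⟩
  | conflict st hr hst hst' hf hT =>
    subst hT
    exact ⟨hS.ground, hS.sound, hf⟩
  | skip Γ b k D σ hr hΓ hst hf hT =>
    subst hT
    refine ⟨hS.ground, Trail.Sound.of_append (hΓ ▸ hS.sound), fun D' σ' e => ?_⟩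
    obtain ⟨rfl, rfl⟩ : D = D' ∧ σ = σ' := by simpa [hst] using e
    exact hf
  | simplify D D' σ σ' hr hst hf hl hT =>
    subst hT
    refine ⟨hS.ground, hS.sound, fun D'' σ'' e => ?_⟩
    obtain ⟨rfl, rfl⟩ : D' = D'' ∧ σ' = σ'' := by simpa using e
    exact hf (hS.conflict_false _ _ hst)
  | backtrack Γ Γ' a D σ k hr hΓ hst hmin hT =>
    subst hT
    exact ⟨hS.ground, Trail.Sound.of_append (hΓ ▸ hS.sound), fun D σ e => by simp at e⟩

theorem StepKind.N_eq (h : StepKind lt r S T) : T.N = S.N := by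
  cases h with
  | _ => simp_all

theorem StepKind.β_eq (h : StepKind lt r S T) : T.β = S.β := by
  cases h with
  | _ => simp_all

theorem StepKind.U_subset (h : StepKind lt r S T) : S.U ⊆ T.U := by
  cases h with
  | backtrack Γ Γ' a D σ k hr hΓ hst hmin hT =>
    subst hT
    exact Set.subset_union_left
  | _ => simp_all

/-- If a clause is `β`-false in a trail, it becomes so by one of its literals, unless it is `β`-false
in the empty trail. -/
theorem exists_becomesFalse (hlt : IsDesiredTermOrdering lt) (hβ : TGround β) {C : Clause L V}
    {τ : Subst L V} (h0 : ¬ ClauseBFalse lt β ∅ (Clause.subst C τ)) (Γ : Trail L V)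
    (h : ClauseBFalse lt β (Trail.lits Γ) (Clause.subst C τ)) :
    ∃ Δ b Ξ, Γ = Δ ++ b :: Ξ ∧ BecomesFalse lt β Δ b C := by
  induction Γ using List.reverseRecOn with
  | nil =>
    refine absurd (h.mono ?_) h0
    rintro K ⟨a, ha, -⟩
    simp at ha
  | append_singleton Γ a ih =>
    by_cases h' : ClauseBFalse lt β (Trail.lits Γ) (Clause.subst C τ)
    · obtain ⟨Δ, b, Ξ, rfl, hb⟩ := ih h'
      exact ⟨Δ, b, Ξ ++ [a], by simp, hb⟩
    · exact ⟨Γ, a, [], rfl, τ, h.ground hlt hβ, h, h'⟩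

/-- No clause has a `β`-false instance in a proper prefix of the trail, unless one has such an
instance in the empty trail. -/
def State.PrefixInv (lt : L.Term V → L.Term V → Prop) (S : State L V) : Prop :=
  ¬ HasFalseInstance lt S.β (S.N ∪ S.U) ∅ →
    ∀ Δ b Ξ, S.trail = Δ ++ b :: Ξ → ¬ HasFalseInstance lt S.β (S.N ∪ S.U) (Trail.lits Δ)

/-- Two kinds of step matter. An extension turns the old trail into a proper prefix, where a false
instance would have given precedence to Conflict. After Backtrack, an instance of the learned clause
false in a proper prefix would have become false before the literal at which the trail was cut,
against the choice of the shortest prefix. -/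
theorem StepKind.prefixInv (hlt : IsDesiredTermOrdering lt) (h : StepKind lt r S T)
    (hβ : TGround S.β)
    (hprec : r = .propagate ∨ r = .decide → ¬ Applicable lt .conflict S)
    (hS : S.PrefixInv lt) : T.PrefixInv lt := by
  intro h0
  cases h with
  | extend a k hr hst hb hu hT =>
    subst hT
    intro Δ b Ξ e
    rcases split_append_singleton e with ⟨rfl, rfl⟩ | ⟨Ξ', e'⟩
    · exact fun hf => hprec hr (hf.applicable_conflict hlt hβ hst)
    · exact hS h0 Δ b Ξ' e'
  | conflict st hr hst hst' hf hT =>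
    subst hT
    exact hS h0
  | skip Γ b k D σ hr hΓ hst hf hT =>
    subst hT
    rintro Δ c Ξ rfl
    exact hS h0 Δ c (Ξ ++ [b]) (by simp [hΓ])
  | simplify D D' σ σ' hr hst hf hl hT =>
    subst hT
    exact hS h0
  | backtrack Γ Γ' a D σ k hr hΓ hst hmin hT =>
    subst hT
    rintro Δ c Ξ rfl ⟨C, hC, τ, hτ⟩
    have h0' : ¬ HasFalseInstance lt S.β (S.N ∪ S.U) ∅ := fun hf =>
      h0 (hf.mono (Set.union_subset_union_right _ Set.subset_union_left) le_rfl)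
    rw [← Set.union_assoc] at hC
    rcases hC with hC | rfl
    · exact hS h0' Δ c (Ξ ++ a :: Γ') (by simp [hΓ]) ⟨C, hC, τ, hτ⟩
    -- An instance false from the start never becomes false, hence the proviso on the empty trail.
    · have h0τ : ¬ ClauseBFalse lt S.β ∅ (Clause.subst C τ) := fun hf =>
        h0 ⟨C, .inr (.inr rfl), τ, hf⟩
      obtain ⟨Δ', b, Ξ', rfl, hb⟩ := exists_becomesFalse hlt hβ h0τ Δ hτ
      have := hmin Δ' (Ξ' ++ c :: (Ξ ++ a :: Γ')) b (by simp [hΓ]) hb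
      simp at this

/-- After Decide of `a`, no clause can have an instance all of whose literals but one are `β`-false
in the old trail and whose remaining literal is `comp a`: Propagate could have added it. -/
theorem DecideStep.not_propagatable (hlt : IsDesiredTermOrdering lt) (hβ : TGround S.β)
    {a : AnnLit L V} (h : DecideStep lt S T a)
    (hno : ∀ (T' : State L V) (a' : AnnLit L V), PropagateStep lt S T' a' →
      a'.clause ∈ S.N ∪ S.U → a.lit ≠ a'.lit.comp)
    {K : Literal L V} {C : Clause L V} (hC : K ::ₘ C ∈ S.N ∪ S.U) {τ : Subst L V}
    (hK : K.subst τ = a.lit.comp)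
    (hf : ClauseBFalse lt S.β (Trail.lits S.trail) (Clause.subst C τ)) : False := by
  obtain ⟨hS, hb, hu, hirr, -, -⟩ := h.spec hlt
  obtain ⟨τ', h1, h2⟩ := exists_normalized_subst hlt (Trail.lits S.trail)
    (Clause.vars (K ::ₘ C)) τ
  have hKirr : ∀ t ∈ (K.subst τ).eqn, Irreducible (conv lt (Trail.lits S.trail)) t := by
    rw [hK]
    exact hirr
  -- Decide appends a normal form, so `τ` is already irreducible on the variables of `K` and
  -- normalization does not change this instance.
  have hK' : K.subst τ' = a.lit.comp := by
    rw [← hK]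
    refine Literal.subst_congr fun x hx => ?_
    refine (h2 x ⟨K, by simp, hx⟩).eq_of_irreducible ?_
    obtain ⟨t, ht, hx⟩ := hx
    exact (hKirr _ (Literal.mem_subst.2 ⟨t, ht, rfl⟩)).of_subst hx
  have hf' : ClauseBFalse lt S.β (Trail.lits S.trail) (Clause.subst C τ') := by
    intro H hH
    obtain ⟨H, hHC, rfl⟩ := Clause.mem_subst.1 hH
    exact (hf _ (Clause.mem_subst.2 ⟨H, hHC, rfl⟩)).normalize hlt fun x hx =>
      h2 x ⟨H, Multiset.mem_cons_of_mem hHC, hx⟩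
  have hKb : LitBelow lt S.β (K.subst τ') := hK' ▸ hb.comp
  have hall : ∀ H ∈ Clause.subst (C + {K}) τ', LitBelow lt S.β H := by
    intro H hH
    rw [Clause.subst_add, Clause.subst_singleton, Multiset.mem_add,
      Multiset.mem_singleton] at hH
    rcases hH with hH | rfl
    · exact (hf' H hH).1
    · exact hKb
  -- Nothing is merged and the literal is in normal form, so a single leaf is a reduction chain
  -- application and the annotation clause is the known clause itself.
  have hstep : PropagateStep lt S { S with trail := S.trail ++ [⟨S.k, K, C, τ'⟩] }
      ⟨S.k, K, C, τ'⟩ := by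
    refine ⟨hS, C, 0, K, τ', Term.var, [.leaf K C τ'], .leaf K C τ', ?_, ?_, ?_, by simp,
      isLitMgu_zero _ _, ?_, ?_, h1, ?_, rfl, rfl, rfl⟩
    · rwa [add_zero, add_comm, Multiset.singleton_add]
    · exact Clause.ground_iff.2 fun H hH => (hall H (by simpa using hH)).ground hlt hβ
    · exact fun H hH => (hf' H hH).2
    · right
      rw [hK', Defined.comp_iff]
      exact hu
    · rw [Clause.subst_var]
      exact clauseBelow_iff.2 hall
    · rw [Literal.subst_var, Clause.subst_var]
      refine ⟨⟨?_, .leaf K C τ', rfl, ?_⟩, ?_⟩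
      · intro i
        left
        refine ⟨⟨S.k, K, C, τ'⟩, by simp, ?_⟩
        have : i = ⟨0, by simp⟩ := Fin.ext (by simp)
        subst this
        rfl
      · refine isLitNormalForm_self ?_
        change ∀ t ∈ (K.subst τ').eqn, _
        rw [hK', ← hK]
        exact hKirr
      · intro i hi
        obtain rfl : i = 0 := by simpa using hi
        rintro ⟨-, I, hI, -⟩
        simp at hI
  refine hno _ _ hstep hC ?_
  change a.lit = (K.subst τ').comp
  rw [hK', Literal.comp_comp]

/-! ### Profiles of ground clauses -/

/-- The literals of a clause, and those that occur in it exactly once. -/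
def Clause.profile (C : Clause L V) : Set (Literal L V) × Set (Literal L V) :=
  ({K | K ∈ C}, {K | ∃ D : Clause L V, C = K ::ₘ D ∧ K ∉ D})

/-- The profiles of the ground instances below `β` of the clauses in `M`. -/
def profiles (lt : L.Term V → L.Term V → Prop) (β : L.Term V) (M : Set (Clause L V)) :
    Set (Set (Literal L V) × Set (Literal L V)) :=
  {p | ∃ C ∈ M, ∃ τ : Subst L V, (∀ K ∈ Clause.subst C τ, LitBelow lt β K) ∧
    p = Clause.profile (Clause.subst C τ)}

theorem profiles_mono {M M' : Set (Clause L V)} (h : M ⊆ M') :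
    profiles lt β M ⊆ profiles lt β M' := by
  rintro p ⟨C, hC, h'⟩
  exact ⟨C, h hC, h'⟩

theorem profiles_subset (M : Set (Clause L V)) :
    profiles lt β M ⊆ 𝒫 {K | LitBelow lt β K} ×ˢ 𝒫 {K | LitBelow lt β K} := by
  rintro p ⟨C, -, τ, h, rfl⟩
  refine ⟨fun K hK => h K hK, ?_⟩
  rintro K ⟨D, hD, -⟩
  exact h K (by simp [hD])

theorem finite_profileSpace (hlt : IsDesiredTermOrdering lt) (hβ : TGround β) :
    (𝒫 {K : Literal L V | LitBelow lt β K} ×ˢ 𝒫 {K : Literal L V | LitBelow lt β K}).Finite :=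
  (finite_litBelow hlt hβ).finite_subsets.prod (finite_litBelow hlt hβ).finite_subsets

/-- A clause that is false in a trail without false instances has a new profile. -/
theorem profile_notMem_of_false {M : Set (Clause L V)} {Γ : Set (Literal L V)}
    {C : Clause L V} (hM : ¬ HasFalseInstance lt β M Γ) (hC : ClauseBFalse lt β Γ C) :
    Clause.profile C ∉ profiles lt β M := by
  rintro ⟨D, hD, τ, -, e⟩
  refine hM ⟨D, hD, τ, fun K hK => hC K ?_⟩
  have := congrArg Prod.fst e
  exact (Set.ext_iff.1 this K).2 hK

/-- A clause learned directly after Decide has a new profile. -/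
theorem DecideStep.profile_notMem (hlt : IsDesiredTermOrdering lt) (hβ : TGround S.β)
    {a : AnnLit L V} (h : DecideStep lt S T a)
    (hno : ∀ (T' : State L V) (a' : AnnLit L V), PropagateStep lt S T' a' →
      a'.clause ∈ S.N ∪ S.U → a.lit ≠ a'.lit.comp)
    {C : Clause L V} (hC : ClauseBFalse lt S.β (Trail.lits (S.trail ++ [a])) (a.lit.comp ::ₘ C))
    (hl : clauseLevel (S.trail ++ [a]) C < a.level) :
    Clause.profile (a.lit.comp ::ₘ C) ∉ profiles lt S.β (S.N ∪ S.U) := by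
  obtain ⟨-, -, hu, -, -, -⟩ := h.spec hlt
  have hdef : ∀ K ∈ C, Defined (Trail.lits S.trail) K := fun K hK =>
    defined_of_litLevel_lt (.inr (hC K (by simp [hK])).2)
      ((litLevel_le_clauseLevel hK).trans_lt hl)
  -- A literal of `C` true in the old trail would be true and false once `a` is added, so the old
  -- trail would entail `comp a`, although `a` is undefined there.
  have hfalse : ClauseBFalse lt S.β (Trail.lits S.trail) C := by
    intro K hK
    refine ⟨(hC K (by simp [hK])).1, (hdef K hK).resolve_left fun hKt => hu (.inr ?_)⟩
    intro M _ val hM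
    rw [Literal.holds_comp]
    intro ha
    have := (hC K (by simp [hK])).2 M val (by
      rw [Trail.lits_append_singleton]
      rintro H (rfl | hH)
      · exact ha
      · exact hM H hH)
    exact Literal.holds_comp.1 this (hKt M val hM)
  -- Hence `comp a` occurs exactly once and is recorded in the second component of the profile.
  have hmem : a.lit.comp ∉ C := fun hm => hu (Defined.comp_iff.1 (hdef _ hm))
  rintro ⟨D, hD, τ, -, e⟩
  have e1 := Set.ext_iff.1 (congrArg Prod.fst e)
  obtain ⟨E, hE, hE'⟩ := (Set.ext_iff.1 (congrArg Prod.snd e) a.lit.comp).1 ⟨C, rfl, hmem⟩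
  obtain ⟨K, hK, hKτ⟩ : ∃ K ∈ D, K.subst τ = a.lit.comp :=
    Clause.mem_subst.1 (by simp [hE])
  obtain ⟨D', rfl⟩ := Multiset.exists_cons_of_mem hK
  have hE2 : Clause.subst D' τ = E := by
    have : a.lit.comp ::ₘ Clause.subst D' τ = a.lit.comp ::ₘ E := by
      rw [← hE, ← hKτ]
      simp [Clause.subst]
    exact (Multiset.cons_inj_right _).1 this
  refine h.not_propagatable hlt hβ hno hD hKτ ?_
  rw [hE2]
  intro H hH
  have := (e1 H).2 (by rw [hE]; exact Multiset.mem_cons_of_mem hH)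
  rcases Multiset.mem_cons.1 this with rfl | hHC
  · exact absurd hH hE'
  · exact hfalse H hHC

end Steps

/-! ### Infinite runs and extensions of finite runs -/

section Runs

variable {L : FirstOrder.Language.{u, v}} {V : Type w} {lt : L.Term V → L.Term V → Prop}
  {β : L.Term V} {N : Set (Clause L V)} {s : ℕ → State L V} {r : ℕ → Rule}

/-- In a conflict state, there is a last application of Conflict, and since then the clause sets
have not changed and the trail can only have become shorter, by Skip. -/
theorem exists_last_conflict (h0 : (s 0).status = .top)
    (hk : ∀ i, StepKind lt (r i) (s i) (s (i + 1))) (i : ℕ) (D : Clause L V) (σ : Subst L V)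
    (hi : (s i).status = .conflict D σ) :
    ∃ j < i, r j = .conflict ∧ (∀ l, j < l → l < i → r l ≠ .conflict) ∧ (s i).N = (s j).N ∧
      (s i).U = (s j).U ∧ ((∃ b Ξ, (s j).trail = (s i).trail ++ b :: Ξ) ∨
        ((s i).trail = (s j).trail ∧ (s i).k = (s j).k ∧ ∀ l, j < l → l < i → r l ≠ .skip)) := by
  induction i generalizing D σ with
  | zero => simp [h0] at hi
  | succ i ih =>
    cases hk i with
    | extend a k hr hS hb hu hT => simp [hT, hS] at hi
    | conflict st hr hS hst hf hT =>
      refine ⟨i, i.lt_succ_self, hr, fun l h1 h2 => by omega, by simp [hT], by simp [hT],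
        .inr ⟨by simp [hT], by simp [hT], fun l h1 h2 => by omega⟩⟩
    | skip Γ b k D σ hr hΓ hS hf hT =>
      obtain ⟨j, hj, h1, h2, hN, hU, h3⟩ := ih D σ hS
      refine ⟨j, by omega, h1, fun l hl hl' => ?_, by simp [hT, hN], by simp [hT, hU], .inl ?_⟩
      · rcases Nat.lt_succ_iff_lt_or_eq.1 hl' with h | rfl
        · exact h2 l hl h
        · simp [hr]
      · rcases h3 with ⟨c, Ξ, h3⟩ | ⟨h3, -⟩
        · exact ⟨b, c :: Ξ, by simp [h3, hΓ, hT]⟩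
        · exact ⟨b, [], by simp [← h3, hΓ, hT]⟩
    | simplify D D' σ σ' hr hS hf hl hT =>
      obtain ⟨j, hj, h1, h2, hN, hU, h3⟩ := ih D σ hS
      refine ⟨j, by omega, h1, fun l hl hl' => ?_, by simp [hT, hN], by simp [hT, hU], ?_⟩
      · rcases Nat.lt_succ_iff_lt_or_eq.1 hl' with h | rfl
        · exact h2 l hl h
        · exact hr.1
      · rcases h3 with ⟨c, Ξ, h3⟩ | ⟨h3, h4, h5⟩
        · exact .inl ⟨c, Ξ, by simp [h3, hT]⟩
        · refine .inr ⟨by simp [h3, hT], by simp [h4, hT], fun l hl hl' => ?_⟩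
          rcases Nat.lt_succ_iff_lt_or_eq.1 hl' with h | rfl
          · exact h5 l hl h
          · exact hr.2.1
    | backtrack Γ Γ' a D σ k hr hΓ hS hmin hT => simp [hT] at hi

/-- An infinite run without Grow uses Backtrack infinitely often. -/
theorem exists_backtrack (hlt : IsDesiredTermOrdering lt)
    (hk : ∀ i, StepKind lt (r i) (s i) (s (i + 1))) (hinv : ∀ i, (s i).Inv lt)
    (i₀ : ℕ) : ∃ i ≥ i₀, r i = .backtrack := by
  by_contra! hb
  -- A conflict that is never left by Backtrack would descend forever: Skip lowers the trail length,
  -- the other rules keep the trail and lower the ground clause in its ordering.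
  have hconf : ∀ ℓ : ℕ, ∀ i ≥ i₀, List.length (s i).trail = ℓ → ∀ D σ,
      (s i).status ≠ .conflict D σ := by
    intro ℓ
    induction ℓ using Nat.strong_induction_on with
    | _ ℓ ih =>
    intro i hi hℓ D σ hD
    generalize hC : Clause.subst D σ = C
    generalize hΓ : (s i).trail = Γ
    generalize hβ' : (s i).β = β'
    have hsound : Trail.Sound lt β' Γ := hΓ ▸ hβ' ▸ (hinv i).sound
    induction C using (wellFounded_trailLT hlt hsound).induction generalizing i D σ with
    | _ C ihC =>
    cases hk i with
    | extend a k hr hS hb hu hT => simp [hS] at hD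
    | conflict st hr hS hst hf hT => simp [hS] at hD
    | skip Δ b k D' σ' hr hΔ hS hf hT =>
      exact ih _ (by simp [← hℓ, hT, hΔ]) (i + 1) (by omega) rfl D' σ' (by simp [hT, hS])
    | simplify D₁ D₂ σ₁ σ₂ hr hS hf hl hT =>
      obtain ⟨rfl, rfl⟩ : D₁ = D ∧ σ₁ = σ := by simpa [hS] using hD
      refine ihC (Clause.subst D₂ σ₂) ⟨?_, ?_⟩ (i + 1) (by omega) (by simp [hT, hℓ]) D₂ σ₂
        (by simp [hT]) rfl (by simp [hT, hΓ]) (by simp [hT, hβ'])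
      · rwa [hΓ, hβ', hC] at hl
      · have := (hinv i).conflict_false _ _ hS
        rwa [hΓ, hβ', hC] at this
    | backtrack Δ Δ' a D σ k hr hΓ hS hmin hT => exact hb i hi hr
  -- Without conflict closures each step extends the trail, since Conflict could only yield `⊥`,
  -- from which the run could not go on.
  have hgrow : ∀ m, List.length (s (i₀ + m)).trail = List.length (s i₀).trail + m := by
    intro m
    induction m with
    | zero => rfl
    | succ m ih =>
      cases hk (i₀ + m) with
      | extend a k hr hS hb hu hT =>
        rw [← add_assoc, hT]
        simp only [List.length_append, ih, List.length_singleton]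
        omega
      | conflict st hr hS hst hf hT =>
        have hst' : (s (i₀ + m + 1)).status = st := by rw [hT]
        have hne := hconf _ (i₀ + m + 1) (by omega) rfl
        cases hk (i₀ + m + 1) with
        | extend a k hr hS hb hu hT => exact absurd (hst'.symm.trans hS) hst
        | conflict st hr hS _ hf hT => exact absurd (hst'.symm.trans hS) hst
        | skip Γ b k D σ hr hΓ hS hf hT => exact absurd hS (hne _ _)
        | simplify D D' σ σ' hr hS hf hl hT => exact absurd hS (hne _ _)
        | backtrack Γ Γ' a D σ k hr hΓ hS hmin hT => exact absurd hS (hne _ _)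
      | skip Γ b k D σ hr hΓ hS hf hT => exact absurd hS (hconf _ _ (by omega) rfl _ _)
      | simplify D D' σ σ' hr hS hf hl hT => exact absurd hS (hconf _ _ (by omega) rfl _ _)
      | backtrack Γ Γ' a D σ k hr hΓ hS hmin hT => exact absurd hr (hb _ (by omega))
  have hβ' : ∀ m, (s (i₀ + m)).β = (s i₀).β := by
    intro m
    induction m with
    | zero => rfl
    | succ m ih => rw [← add_assoc, (hk _).β_eq, ih]
  have hle := (hinv (i₀ + ({K : Literal L V | LitBelow lt (s i₀).β K}.ncard + 1))).sound.length_le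
    hlt (hinv _).ground
  rw [hgrow, hβ'] at hle
  omega

theorem not_eventually_descending {p : ℕ → Prop} (hp : ∀ i₀, ∃ i ≥ i₀, p i) (f : ℕ → ℕ) (i₀ : ℕ)
    (hle : ∀ i ≥ i₀, f (i + 1) ≤ f i) (hlt : ∀ i ≥ i₀, p i → f (i + 1) < f i) : False := by
  have hanti : ∀ i ≥ i₀, ∀ m, f (i + m) ≤ f i := by
    intro i hi m
    induction m with
    | zero => rfl
    | succ m ih => exact (hle (i + m) (by omega)).trans ih
  have key : ∀ m, ∀ i ≥ i₀, f i ≠ m := by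
    intro m
    induction m using Nat.strong_induction_on with
    | _ m ih =>
    rintro i hi rfl
    obtain ⟨j, hj, hpj⟩ := hp i
    obtain ⟨d, rfl⟩ := Nat.exists_eq_add_of_le hj
    exact ih _ ((hlt _ (by omega) hpj).trans_le (hanti i hi d)) (i + d + 1) (by omega) rfl
  exact key _ i₀ le_rfl rfl

/-- If no clause has a `β`-false instance in the empty trail, then Backtrack learns a clause with a
new profile. -/
theorem IsRegularRun.exists_new_profile (hlt : IsDesiredTermOrdering lt)
    (hrun : IsRegularRun lt N β ⊤ s r)
    (hk : ∀ i, StepKind lt (r i) (s i) (s (i + 1))) (hinv : ∀ i, (s i).Inv lt)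
    (hpre : ∀ i, (s i).PrefixInv lt) (hβ' : ∀ i, (s i).β = β)
    (hbad : ∀ i, ¬ HasFalseInstance lt β ((s i).N ∪ (s i).U) ∅) {i : ℕ}
    (hi : r i = .backtrack) :
    ∃ p ∈ profiles lt β ((s (i + 1)).N ∪ (s (i + 1)).U),
      p ∉ profiles lt β ((s i).N ∪ (s i).U) := by
  have htop : ∀ i : ℕ, (i : ℕ∞) < ⊤ := ENat.natCast_lt_top
  have hstep := hrun.run.2 i (htop i)
  rw [hi] at hstep
  obtain ⟨Γ, Γ', a, D, K, σ, -, hS, hlev, -, -, hT⟩ := hstep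
  have hfalse := (hinv i).conflict_false _ _ hS
  refine ⟨Clause.profile (Clause.subst (D + {K}) σ),
    ⟨D + {K}, by simp [hT], σ, fun H hH => hβ' i ▸ (hfalse H hH).1, rfl⟩, ?_⟩
  obtain ⟨j, hj, hrj, hlast, hN, hU, hj'⟩ :=
    exists_last_conflict (by rw [hrun.run.1]; rfl) hk i _ _ hS
  rw [hN, hU]
  -- Either Skip has cut the trail since the last Conflict, or trail and level are unchanged since
  -- then.
  rcases hj' with ⟨b, Ξ, hΞ⟩ | ⟨htr, hkk, hskip⟩
  · have := hpre j (by rw [hβ' j]; exact hbad j) _ _ _ hΞ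
    rw [hβ' j] at this
    rw [hβ' i] at hfalse
    exact profile_notMem_of_false this hfalse
  · have hdec : 0 < j ∧ r (j - 1) = .decide := by
      by_contra hnd
      obtain ⟨l, h1, h2, h3⟩ := hrun.skip_once i j (htop i) hi hj hrj hlast hnd
      exact hskip l h1 h2 h3
    obtain ⟨Δ, c, D', σ', hΔ, hS', K', hK', hKc⟩ :=
      hrun.after_decide i j (htop i) hi hj hrj hlast hdec
    obtain ⟨rfl, rfl⟩ : D + {K} = D' ∧ σ = σ' := by simpa [hS] using hS'
    obtain ⟨hj0, hrd⟩ := hdec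
    obtain ⟨j, rfl⟩ : ∃ j', j = j' + 1 := ⟨j - 1, by omega⟩
    rw [Nat.add_sub_cancel] at hrd
    have hstep := hrun.run.2 j (htop j)
    rw [hrd] at hstep
    obtain ⟨b, hb⟩ := hstep
    obtain ⟨-, -, hu, -, hbl, hT'⟩ := hb.spec hlt
    have htrj : (s (j + 1)).trail = (s j).trail ++ [b] := by rw [hT']
    obtain ⟨rfl, hcb⟩ := List.append_inj' (hΔ.symm.trans (htr.trans htrj)) rfl
    obtain rfl : c = b := by simpa using hcb
    have hki : (s i).k = c.level := by rw [hkk, hT', hbl]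
    rw [hΔ, hki] at hlev
    rw [hΔ] at hfalse
    -- The level condition of Backtrack makes all of `D` defined before the decision, so the
    -- complement required by regularity can only come from `K`.
    have hnot : c.lit.comp ∉ Clause.subst D σ := by
      intro hm
      have hd := defined_of_litLevel_lt
        (.inr (hfalse c.lit.comp (by rw [Clause.subst_add]; exact Multiset.mem_add.2 (.inl hm))).2)
        ((litLevel_le_clauseLevel hm).trans_lt hlev)
      exact hu (Defined.comp_iff.1 hd)
    have hKK : K.subst σ = c.lit.comp := by
      rcases Multiset.mem_add.1 hK' with h | h
      · exact absurd (Clause.mem_subst.2 ⟨K', h, hKc⟩) hnot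
      · rw [← Multiset.mem_singleton.1 h, hKc]
    have e : Clause.subst (D + {K}) σ = c.lit.comp ::ₘ Clause.subst D σ := by
      rw [Clause.subst_add, Clause.subst_singleton, hKK, add_comm, Multiset.singleton_add]
    rw [e] at hfalse ⊢
    have hnew := hb.profile_notMem hlt (hinv j).ground
      (fun T' a' hp hm => hrun.no_complement j (htop j) hrd T' a' c hp hm htrj)
      (by rwa [hβ' i, ← hβ' j] at hfalse) hlev
    rw [hβ' j] at hnew
    rwa [hT']

theorem IsRegularRun.not_infinite (hlt : IsDesiredTermOrdering lt) (hβ : TGround β)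
    (hrun : IsRegularRun lt N β ⊤ s r) (hgrow : ∀ i, r i ≠ .grow) : False := by
  have htop : ∀ i : ℕ, (i : ℕ∞) < ⊤ := ENat.natCast_lt_top
  have hk : ∀ i, StepKind lt (r i) (s i) (s (i + 1)) := fun i =>
    (hrun.run.2 i (htop i)).kind hlt (hgrow i)
  have h0 := hrun.run.1
  have hinv : ∀ i, (s i).Inv lt := by
    intro i
    induction i with
    | zero =>
      rw [h0]
      exact ⟨hβ, Trail.sound_nil, fun D σ h => by simp [initialState] at h⟩
    | succ i ih => exact (hk i).inv ih
  have hprec : ∀ i, r i = .propagate ∨ r i = .decide → ¬ Applicable lt .conflict (s i) := by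
    intro i hi
    refine (hrun.precedence i (htop i) ?_ ?_).1 <;> rcases hi with hi | hi <;> simp [hi]
  have hpre : ∀ i, (s i).PrefixInv lt := by
    intro i
    induction i with
    | zero =>
      rw [h0]
      intro _ Δ b Ξ h
      simp [initialState] at h
    | succ i ih => exact (hk i).prefixInv hlt (hinv i).ground (hprec i) ih
  have hβ' : ∀ i, (s i).β = β := by
    intro i
    induction i with
    | zero => rw [h0]; rfl
    | succ i ih => rw [(hk i).β_eq, ih]
  have hmono : ∀ i, (s i).N ∪ (s i).U ⊆ (s (i + 1)).N ∪ (s (i + 1)).U := fun i => by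
    rw [(hk i).N_eq]
    exact Set.union_subset_union_right _ (hk i).U_subset
  have hback := exists_backtrack hlt hk hinv
  -- In the degenerate case the descending measure is the trail length, in the other one the number
  -- of profiles not yet realized.
  by_cases hbad : ∃ i, HasFalseInstance lt β ((s i).N ∪ (s i).U) ∅
  · obtain ⟨i₀, hbad⟩ := hbad
    have hbad' : ∀ i ≥ i₀, HasFalseInstance lt β ((s i).N ∪ (s i).U) ∅ := by
      intro i hi
      induction i, hi using Nat.le_induction with
      | base => exact hbad
      | succ i _ ih => exact ih.mono (hmono i) le_rfl
    have hlen : ∀ i ≥ i₀, List.length (s (i + 1)).trail ≤ List.length (s i).trail ∧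
        (r i = .backtrack → List.length (s (i + 1)).trail < List.length (s i).trail) := by
      intro i hi
      cases hk i with
      | extend a k hr hS hb hu hT =>
        refine absurd (HasFalseInstance.applicable_conflict hlt (hinv i).ground hS ?_) (hprec i hr)
        rw [hβ' i]
        exact (hbad' i hi).mono le_rfl (Set.empty_subset _)
      | conflict st hr hS hst hf hT => simp [hT, hr]
      | skip Γ b k D σ hr hΓ hS hf hT => simp [hT, hr, hΓ]
      | simplify D D' σ σ' hr hS hf hl hT => simp [hT, hr]
      | backtrack Γ Γ' a D σ k hr hΓ hS hmin hT => simp [hT, hΓ]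
    exact not_eventually_descending hback (fun i => List.length (s i).trail) i₀
      (fun i hi => (hlen i hi).1) fun i hi => (hlen i hi).2
  · push Not at hbad
    have hfin : ∀ i, (profiles lt β ((s i).N ∪ (s i).U)).Finite := fun i =>
      (finite_profileSpace hlt hβ).subset (profiles_subset _)
    have hbound : ∀ i, (profiles lt β ((s i).N ∪ (s i).U)).ncard ≤ _ := fun i =>
      Set.ncard_le_ncard (profiles_subset _) (finite_profileSpace hlt hβ)
    refine not_eventually_descending hback
      (fun i => (𝒫 {K : Literal L V | LitBelow lt β K} ×ˢ
        𝒫 {K : Literal L V | LitBelow lt β K}).ncard -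
          (profiles lt β ((s i).N ∪ (s i).U)).ncard) 0 (fun i _ => ?_) fun i _ hi => ?_
    · exact Nat.sub_le_sub_left (Set.ncard_le_ncard (profiles_mono (hmono i)) (hfin _)) _
    · obtain ⟨p, hp, hp'⟩ := hrun.exists_new_profile hlt hk hinv hpre hβ' hbad hi
      have hss : profiles lt β ((s i).N ∪ (s i).U) ⊂
          profiles lt β ((s (i + 1)).N ∪ (s (i + 1)).U) :=
        ⟨profiles_mono (hmono i), fun h => hp' (h hp)⟩
      have := Set.ncard_lt_ncard hss (hfin _)
      have := hbound (i + 1)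
      omega

/-- A regular run can be extended by Conflict, and by Propagate or Decide if no rule with
precedence is applicable. -/
theorem IsRegularRun.extend {m : ℕ} (hrun : IsRegularRun lt N β m s r) {q : Rule} {T : State L V}
    (hq : Step lt q (s m) T) (hb : q ≠ .backtrack)
    (hc : q ≠ .conflict → q ≠ .factorize →
      ¬ Applicable lt .conflict (s m) ∧ ¬ Applicable lt .factorize (s m))
    (hp : q = .decide → ¬ Applicable lt .propagate (s m)) :
    IsRegularRun lt N β ((m + 1 : ℕ) : ℕ∞) (Function.update s (m + 1) T)
      (Function.update r m q) := by
  have hs : ∀ i ≤ m, Function.update s (m + 1) T i = s i := fun i hi =>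
    Function.update_of_ne (by omega) _ _
  have hr : ∀ i < m, Function.update r m q i = r i := fun i hi =>
    Function.update_of_ne (by omega) _ _
  have hrm : Function.update r m q m = q := Function.update_self ..
  have hsm : Function.update s (m + 1) T (m + 1) = T := Function.update_self ..
  have cases_lt : ∀ i : ℕ, (i : ℕ∞) < ((m + 1 : ℕ) : ℕ∞) → i < m ∨ i = m := fun i hi => by
    have : i < m + 1 := by exact_mod_cast hi
    omega
  -- The new step is not Backtrack, so the two regularity conditions on Backtrack concern old steps
  -- only.
  have hback : ∀ i : ℕ, (i : ℕ∞) < ((m + 1 : ℕ) : ℕ∞) → Function.update r m q i = .backtrack →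
      i < m := fun i hi e => by
    rcases cases_lt i hi with h | rfl
    · exact h
    · exact absurd (hrm.symm.trans e) hb
  refine ⟨⟨?_, fun i hi => ?_⟩, fun i hi => ?_, fun i hi => ?_, fun i hi => ?_, fun i j hi hri => ?_,
    fun i j hi hri => ?_⟩
  · rw [hs 0 (Nat.zero_le _)]
    exact hrun.run.1
  · rcases cases_lt i hi with h | rfl
    · rw [hs i h.le, hs (i + 1) h, hr i h]
      exact hrun.run.2 i (by exact_mod_cast h)
    · rw [hs i le_rfl, hsm, hrm]
      exact hq
  · rcases cases_lt i hi with h | rfl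
    · rw [hs i h.le, hr i h]
      exact hrun.precedence i (by exact_mod_cast h)
    · rw [hs i le_rfl, hrm]
      exact hc
  · rcases cases_lt i hi with h | rfl
    · rw [hs i h.le, hr i h]
      exact hrun.propagate_first i (by exact_mod_cast h)
    · rw [hs i le_rfl, hrm]
      exact fun e _ => hp e
  · rcases cases_lt i hi with h | rfl
    · rw [hs i h.le, hs (i + 1) h, hr i h]
      exact hrun.no_complement i (by exact_mod_cast h)
    · rw [hs i le_rfl, hrm]
      -- With Propagate inapplicable, the condition on complements is vacuous.
      exact fun e T' a b ha => absurd ⟨T', a, ha⟩ (hp e)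
  · have h := hback i hi hri
    rw [hr i h] at hri
    intro hj hrj hl hd
    rw [hr j (by omega)] at hrj
    obtain ⟨l, h1, h2, h3⟩ := hrun.skip_once i j (by exact_mod_cast h) hri hj hrj
      (fun l h1 h2 => by rw [← hr l (by omega)]; exact hl l h1 h2)
      (by rwa [hr (j - 1) (by omega)] at hd)
    exact ⟨l, h1, h2, by rw [hr l (by omega)]; exact h3⟩
  · have h := hback i hi hri
    rw [hr i h] at hri
    intro hj hrj hl hd
    rw [hr j (by omega)] at hrj
    rw [hs i h.le]
    exact hrun.after_decide i j (by exact_mod_cast h) hri hj hrj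
      (fun l h1 h2 => by rw [← hr l (by omega)]; exact hl l h1 h2)
      (by rwa [hr (j - 1) (by omega)] at hd)

end Runs

end SCLEQ

/-! ### The termination lemma -/

theorem mainTheorem4 {L : FirstOrder.Language.{u, v}} {V : Type w} [Infinite V]
    (lt : L.Term V → L.Term V → Prop) (hlt : SCLEQ.IsDesiredTermOrdering lt)
    (N : Set (SCLEQ.Clause L V)) (β : L.Term V) (hβ : SCLEQ.TGround β)
    (n : ℕ∞) (s : ℕ → SCLEQ.State L V) (r : ℕ → SCLEQ.Rule)
    (hrun : SCLEQ.IsRegularRun lt N β n s r)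
    (hgrow : ∀ i : ℕ, (i : ℕ∞) < n → r i ≠ SCLEQ.Rule.grow) :
    -- the run is finite
    n ≠ ⊤ ∧
    -- if it ends with status `⊤` and has no regular continuation, no rule but Grow is applicable
    (∀ m : ℕ, n = m → (s m).status = SCLEQ.Status.top →
      (¬ ∃ (s' : ℕ → SCLEQ.State L V) (r' : ℕ → SCLEQ.Rule),
        SCLEQ.IsRegularRun lt N β ((m + 1 : ℕ) : ℕ∞) s' r' ∧ r' m ≠ SCLEQ.Rule.grow ∧
        (∀ i ≤ m, s' i = s i) ∧ (∀ i < m, r' i = r i)) →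
      ∀ q : SCLEQ.Rule, q ≠ SCLEQ.Rule.grow → ¬ SCLEQ.Applicable lt q (s m)) := by
  constructor
  · rintro rfl
    exact hrun.not_infinite hlt hβ fun i => hgrow i (ENat.natCast_lt_top i)
  · rintro m rfl hS hext
    have key : ∀ q : SCLEQ.Rule, q ≠ .backtrack → q ≠ .grow →
        (q ≠ .conflict → q ≠ .factorize →
          ¬ SCLEQ.Applicable lt .conflict (s m) ∧ ¬ SCLEQ.Applicable lt .factorize (s m)) →
        (q = .decide → ¬ SCLEQ.Applicable lt .propagate (s m)) →
        ¬ SCLEQ.Applicable lt q (s m) := by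
      rintro q hb hg hc hp ⟨T, hT⟩
      refine hext ⟨_, _, hrun.extend hT hb hc hp, ?_, fun i hi => ?_, fun i hi => ?_⟩
      · rwa [Function.update_self]
      · exact Function.update_of_ne (by omega) _ _
      · exact Function.update_of_ne (by omega) _ _
    have hfac : ¬ SCLEQ.Applicable lt .factorize (s m) := by
      rintro ⟨T, D, K, K', σ, μ, h, -⟩
      simp [hS] at h
    -- The order matters: each exclusion supplies the precedence hypotheses for the next rule.
    have hcon := key .conflict (by simp) (by simp) (by simp) (by simp)
    have hpro := key .propagate (by simp) (by simp) (fun _ _ => ⟨hcon, hfac⟩) (by simp)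
    have hdec := key .decide (by simp) (by simp) (fun _ _ => ⟨hcon, hfac⟩) fun _ => hpro
    intro q hq
    cases q with
    | propagate => exact hpro
    | decide => exact hdec
    | conflict => exact hcon
    | skip =>
      rintro ⟨T, Γ, a, b, D, σ, -, h, -⟩
      simp [hS] at h
    | exploreRefutation =>
      rintro ⟨T, D, K, σ, i, P, I, h, -⟩
      simp [hS] at h
    | factorize => exact hfac
    | equalityResolution =>
      rintro ⟨T, D, s₁, s₂, σ, μ, h, -⟩
      simp [hS] at h
    | backtrack =>
      rintro ⟨T, Γ, Γ', a, D, K, σ, -, h, -⟩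
      simp [hS] at h
    | grow => exact absurd rfl hq
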